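/- Let $(\widetilde M, J, g)$ be a complex space form $\widetilde M(c)$, that is, a smooth almost Hermitian manifold with $\nabla J = 0$ (a Kaehler manifold) such that for some real constant $c$ every holomorphic sectional curvature $g(\widetilde R(X,JX)JX,X)$, $X$ a unit vector, equals $c$. Let $M$ be a Lagrangian submanifold of $\widetilde M(c)$ of real dimension $n \ge 2$, that is, an isometrically immersed $n$-dimensional Riemannian manifold with $J(T_qM) = T_q^{\perp}M$ for every $q \in M$. Let $\sigma$ be its second fundamental form and $H = \frac1n \operatorname{trace}\sigma$ its mean curvature vector. Then for every $p\in M$ and every unit vector $X \in T_pM$, the Ricci curvature of $M$ satisfies $$\operatorname{Ric}(X) \le \frac{n-1}{4}\,\bigl(c + n\|H(p)\|^2\bigr),$$ where $\operatorname{Ric}(X)=\sum_{j=1}^n g(R(e_j,X)X,e_j)$ for any orthonormal basis $(e_j)$ of $T_pM$. Equality holds for all unit vectors $X \in T_pM$ if and only if either $p$ is a geodesic point, i.e. $\sigma = 0$ at $p$, or $n = 2$ and $p$ is an $H$-umbilical point with $\lambda = 3\mu$, i.e. there are an orthonormal basis $\{e_1, e_2\}$ of $T_pM$ and a real number $\mu$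 with $$\sigma(e_1,e_1) = 3\mu\, Je_1,\qquad \sigma(e_2,e_2) = \mu\, Je_1,\qquad \sigma(e_1,e_2) = \mu\, Je_2 .$$ -/

import Mathlib

open scoped Manifold ContDiff
set_option maxSynthPendingDepth 3

noncomputable section

namespace KaehlerGeometry

/-! ## Riemannian geometry in one coordinate system

`G x u v` is the value at the point `x` of a vector space of a metric on the coordinate vectors
`u` and `v`. -/

section Coordinates

variable {E : Type*} [NormedAddCommGroup E] [NormedSpace ℝ E]

/-- The trilinear form `(u, v, w) ↦ ∂_w G(u, v)`. -/
def derivLast (G : E → E →L[ℝ] E →L[ℝ] ℝ) (x : E) : E →L[ℝ] E →L[ℝ] E →L[ℝ] ℝ :=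
  ContinuousLinearMap.comp
    ((ContinuousLinearMap.flipₗᵢ ℝ E E ℝ).toContinuousLinearEquiv :
      (E →L[ℝ] E →L[ℝ] ℝ) →L[ℝ] (E →L[ℝ] E →L[ℝ] ℝ))
    (fderiv ℝ G x).flip

/-- The Christoffel symbols of the first kind, as a trilinear form:
`(u, v, w) ↦ 1/2 * (∂_u G(v, w) + ∂_v G(u, w) - ∂_w G(u, v))`. -/
def christoffelFirst (G : E → E →L[ℝ] E →L[ℝ] ℝ) (x : E) : E →L[ℝ] E →L[ℝ] E →L[ℝ] ℝ :=
  (1 / 2 : ℝ) • (fderiv ℝ G x + (fderiv ℝ G x).flip - derivLast G x)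

theorem christoffelFirst_apply (G : E → E →L[ℝ] E →L[ℝ] ℝ) (x u v w : E) :
    christoffelFirst G x u v w =
      1 / 2 * (fderiv ℝ G x u v w + fderiv ℝ G x v u w - fderiv ℝ G x w u v) := by
  simp [christoffelFirst, derivLast]

/-- The Levi-Civita connection of `G` in coordinates (Christoffel symbols of the second kind):
`Γ(u, v)` is the vector with `G(Γ(u, v), w) = christoffelFirst G x u v w` for all `w`.
For fields with coordinate expressions `U`, `V` one has `∇_U V = ∂_U V + Γ(U, V)`. -/
def christoffel (G : E → E →L[ℝ] E →L[ℝ] ℝ) (x : E) : E →L[ℝ] E →L[ℝ] E :=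
  (ContinuousLinearMap.compL ℝ E (E →L[ℝ] ℝ) E (G x).inverse).comp (christoffelFirst G x)

theorem christoffel_apply (G : E → E →L[ℝ] E →L[ℝ] ℝ) (x u v : E) :
    christoffel G x u v = (G x).inverse (christoffelFirst G x u v) := by
  simp [christoffel]

/-- The curvature operator `R(u, v) w = ∇_u ∇_v w - ∇_v ∇_u w` for coordinate (constant) vector
fields `u`, `v`, `w`, at the point `x`. -/
def curvatureOp (G : E → E →L[ℝ] E →L[ℝ] ℝ) (x u v w : E) : E :=
  fderiv ℝ (christoffel G) x u v w - fderiv ℝ (christoffel G) x v u w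
    + christoffel G x u (christoffel G x v w) - christoffel G x v (christoffel G x u w)

/-- The Ricci tensor `S(u, v)`, the trace of `w ↦ R(w, u) v`; it equals
`∑ j, G(R(e_j, u) v, e_j)` for every `G`-orthonormal basis `e`. -/
def ricciTensor (G : E → E →L[ℝ] E →L[ℝ] ℝ) (x u v : E) : ℝ :=
  LinearMap.trace ℝ E
    { toFun := fun w => curvatureOp G x w u v
      map_add' := fun a b => by
        simp only [curvatureOp, map_add, add_apply]
        abel
      map_smul' := fun r a => by
        simp only [curvatureOp, map_smul, smul_apply, RingHom.id_apply,
          smul_add, smul_sub] }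

end Coordinates

/-! ## Riemannian manifolds

For a point `p` the tangent space `TangentSpace 𝓘(ℝ, E) p` is, by its construction, the space `E` of
coordinate vectors in the preferred chart `extChartAt 𝓘(ℝ, E) p` at `p`. Tensors at `p` are computed
in this chart. -/

section Riemannian

variable {E : Type*} [NormedAddCommGroup E] [NormedSpace ℝ E]
  {M : Type*} [TopologicalSpace M] [ChartedSpace E M] [IsManifold 𝓘(ℝ, E) ∞ M]

variable (E M) in
/-- Smooth Riemannian metrics on the manifold `M`. -/
abbrev RiemMetric : Type _ :=
  Bundle.ContMDiffRiemannianMetric 𝓘(ℝ, E) ∞ E (fun x : M => TangentSpace 𝓘(ℝ, E) x)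

/-- The metric at `q`, as a bilinear form on the model space `E = T_q M`. -/
def metricAt (g : RiemMetric E M) (q : M) : E →L[ℝ] E →L[ℝ] ℝ := g.inner q

/-- The differential at `y` of the inverse of the chart at `x₀`: it sends a coordinate vector in that
chart to the tangent vector at the point `q` with coordinates `y`, as an element of `E = T_q M`. -/
def fromChart (x₀ : M) (y : E) : E →L[ℝ] E :=
  mfderiv 𝓘(ℝ, E) 𝓘(ℝ, E) (extChartAt 𝓘(ℝ, E) x₀).symm y

/-- The differential of the chart at `x₀` at the point with coordinates `y`. -/
def toChart (x₀ : M) (y : E) : E →L[ℝ] E :=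
  mfderiv 𝓘(ℝ, E) 𝓘(ℝ, E) (extChartAt 𝓘(ℝ, E) x₀) ((extChartAt 𝓘(ℝ, E) x₀).symm y)

/-- The coordinate expression of the metric `g` in the chart at `x₀`. -/
def metricInChart (g : RiemMetric E M) (x₀ : M) (y : E) : E →L[ℝ] E →L[ℝ] ℝ :=
  (metricAt g ((extChartAt 𝓘(ℝ, E) x₀).symm y)).bilinearComp (fromChart x₀ y) (fromChart x₀ y)

/-- The Riemann curvature operator `R(u, v) w` of `g` at `p`. -/
def curvature (g : RiemMetric E M) (p : M) (u v w : TangentSpace 𝓘(ℝ, E) p) :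
    TangentSpace 𝓘(ℝ, E) p :=
  curvatureOp (E := E) (metricInChart g p) (extChartAt 𝓘(ℝ, E) p p) u v w

/-- The Ricci curvature `Ric(v) = S(v, v)` of `g` at `p`. -/
def ricci (g : RiemMetric E M) (p : M) (v : TangentSpace 𝓘(ℝ, E) p) : ℝ :=
  ricciTensor (E := E) (metricInChart g p) (extChartAt 𝓘(ℝ, E) p p) v v

end Riemannian

/-! ## Kaehler manifolds and complex space forms -/

section Kaehler

variable {E : Type*} [NormedAddCommGroup E] [NormedSpace ℝ E]
  (M : Type*) [TopologicalSpace M] [ChartedSpace E M] [IsManifold 𝓘(ℝ, E) ∞ M]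

variable (E) in
/-- Smooth almost complex structures on `M`. -/
structure AlmostComplex where
  /-- the endomorphism `J` of each tangent space -/
  J : ∀ q : M, TangentSpace 𝓘(ℝ, E) q →L[ℝ] TangentSpace 𝓘(ℝ, E) q
  sq : ∀ (q : M) (v : TangentSpace 𝓘(ℝ, E) q), J q (J q v) = -v
  contMDiff : ContMDiff 𝓘(ℝ, E) (𝓘(ℝ, E).prod 𝓘(ℝ, E →L[ℝ] E)) ∞
    (fun q => Bundle.TotalSpace.mk' (E →L[ℝ] E)
      (E := fun q : M => TangentSpace 𝓘(ℝ, E) q →L[ℝ] TangentSpace 𝓘(ℝ, E) q) q (J q))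

variable {M}

/-- The endomorphism `J` at `q`, as an endomorphism of the model space `E = T_q M`. -/
def complexAt (𝒥 : AlmostComplex E M) (q : M) : E →L[ℝ] E := 𝒥.J q

/-- The coordinate expression of `J` in the chart at `x₀`. -/
def complexInChart (𝒥 : AlmostComplex E M) (x₀ : M) (y : E) : E →L[ℝ] E :=
  (toChart x₀ y).comp ((complexAt 𝒥 ((extChartAt 𝓘(ℝ, E) x₀).symm y)).comp (fromChart x₀ y))

/-- `(M, J, g)` is almost Hermitian: `g(JX, JY) = g(X, Y)`. -/
def IsAlmostHermitian (g : RiemMetric E M) (𝒥 : AlmostComplex E M) : Prop :=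
  ∀ (q : M) (u v : TangentSpace 𝓘(ℝ, E) q), g.inner q (𝒥.J q u) (𝒥.J q v) = g.inner q u v

/-- `∇J = 0`, that is `∇_u (J v) = J (∇_u v)` for all coordinate vector fields `u`, `v` of the
preferred charts; the charts cover `M`, so this says that the tensor field `∇J` vanishes. -/
def IsParallel (g : RiemMetric E M) (𝒥 : AlmostComplex E M) : Prop :=
  ∀ (x₀ : M), ∀ y ∈ (extChartAt 𝓘(ℝ, E) x₀).target, ∀ u v : E,
    fderiv ℝ (complexInChart 𝒥 x₀) y u v
        + christoffel (metricInChart g x₀) y u (complexInChart 𝒥 x₀ y v)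
      = complexInChart 𝒥 x₀ y (christoffel (metricInChart g x₀) y u v)

/-- `(M, J, g)` is a Kaehler manifold. -/
structure IsKaehler (g : RiemMetric E M) (𝒥 : AlmostComplex E M) : Prop where
  hermitian : IsAlmostHermitian g 𝒥
  parallel : IsParallel g 𝒥

/-- `(M, J, g)` is a complex space form `M(c)`: a Kaehler manifold all of whose holomorphic
sectional curvatures `g(R(X, JX) JX, X)`, `X` a unit vector, are equal to `c`. -/
structure IsComplexSpaceForm (g : RiemMetric E M) (𝒥 : AlmostComplex E M) (c : ℝ) : Prop
    extends IsKaehler g 𝒥 where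
  holomorphic_curvature : ∀ (q : M) (v : TangentSpace 𝓘(ℝ, E) q), g.inner q v v = 1 →
    g.inner q (curvature g q v (𝒥.J q v) (𝒥.J q v)) v = c

end Kaehler

/-! ## Submanifolds

A submanifold is given by an isometric immersion `f : M → N`. -/

section Submanifold

variable {E : Type*} [NormedAddCommGroup E] [NormedSpace ℝ E]
  {M : Type*} [TopologicalSpace M] [ChartedSpace E M] [IsManifold 𝓘(ℝ, E) ∞ M]
  {F : Type*} [NormedAddCommGroup F] [NormedSpace ℝ F]
  {N : Type*} [TopologicalSpace N] [ChartedSpace F N] [IsManifold 𝓘(ℝ, F) ∞ N]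

/-- `f` is a smooth isometric immersion of `(M, g)` into `(N, h)`, that is `g = f^* h`. (The
differential of such a map is injective because `g` is positive definite.) -/
structure IsIsometricImmersion (g : RiemMetric E M) (h : RiemMetric F N) (f : M → N) : Prop where
  contMDiff : ContMDiff 𝓘(ℝ, E) 𝓘(ℝ, F) ∞ f
  isometric : ∀ (p : M) (u v : TangentSpace 𝓘(ℝ, E) p),
    h.inner (f p) (mfderiv 𝓘(ℝ, E) 𝓘(ℝ, F) f p u) (mfderiv 𝓘(ℝ, E) 𝓘(ℝ, F) f p v)
      = g.inner p u v

/-- The normal space at `p` of the submanifold `f`. -/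
def normalSpace (h : RiemMetric F N) (f : M → N) (p : M) : Set (TangentSpace 𝓘(ℝ, F) (f p)) :=
  {w | ∀ v : TangentSpace 𝓘(ℝ, E) p, h.inner (f p) w (mfderiv 𝓘(ℝ, E) 𝓘(ℝ, F) f p v) = 0}

/-- The submanifold `f` is Lagrangian: `J` carries each tangent space of the submanifold onto the
normal space. -/
def IsLagrangian (h : RiemMetric F N) (𝒥 : AlmostComplex F N) (f : M → N) : Prop :=
  ∀ p : M, (𝒥.J (f p)) '' Set.range (mfderiv 𝓘(ℝ, E) 𝓘(ℝ, F) f p) =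
    normalSpace (E := E) h f p

/-- The second fundamental form `σ(u, v) = ∇^N_u (df v) - df (∇^M_u v)` (Gauss formula), computed
for coordinate vector fields in the charts at `p` and at `f p`. -/
def secondFundamentalForm (g : RiemMetric E M) (h : RiemMetric F N) (f : M → N) (p : M)
    (u v : TangentSpace 𝓘(ℝ, E) p) : TangentSpace 𝓘(ℝ, F) (f p) :=
  let φ : E → F := writtenInExtChartAt 𝓘(ℝ, E) 𝓘(ℝ, F) p f
  let x : E := extChartAt 𝓘(ℝ, E) p p
  (fderiv ℝ (fderiv ℝ φ) x u v
      + christoffel (metricInChart h (f p)) (φ x) (fderiv ℝ φ x u) (fderiv ℝ φ x v)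
      - fderiv ℝ φ x (christoffel (metricInChart g p) x u v) : F)

/-- A `g`-orthonormal family of tangent vectors at `p`. -/
def OrthonormalAt (g : RiemMetric E M) (p : M) {ι : Type*} [DecidableEq ι]
    (e : ι → TangentSpace 𝓘(ℝ, E) p) : Prop :=
  ∀ i j, g.inner p (e i) (e j) = if i = j then 1 else 0

/-- The tangent vector `♯ℓ` at `p` with `g(♯ℓ, w) = ℓ w` for all `w`. -/
def sharp (g : RiemMetric E M) (p : M) (ℓ : E →L[ℝ] ℝ) : TangentSpace 𝓘(ℝ, E) p :=
  (metricAt g p).inverse ℓ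

/-- The mean curvature vector `H = (1 / n) trace σ`, `n = dim M`. The trace with respect to `g` is
the contraction `∑ i, σ(b i, ♯(b^i))` for a basis `b` with dual basis `b^i`, which equals
`∑ i, σ(e_i, e_i)` for every `g`-orthonormal basis `e`. -/
def meanCurvature [FiniteDimensional ℝ E] (g : RiemMetric E M) (h : RiemMetric F N) (f : M → N)
    (p : M) : TangentSpace 𝓘(ℝ, F) (f p) :=
  ((Module.finrank ℝ E : ℝ)⁻¹) • ∑ i,
    secondFundamentalForm g h f p (Module.finBasis ℝ E i)
      (sharp g p (LinearMap.toContinuousLinearMap ((Module.finBasis ℝ E).coord i)))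

/-- `p` is a geodesic point: `σ` vanishes at `p`. -/
def IsGeodesicPoint (g : RiemMetric E M) (h : RiemMetric F N) (f : M → N) (p : M) : Prop :=
  ∀ u v : TangentSpace 𝓘(ℝ, E) p, secondFundamentalForm g h f p u v = 0

/-- `p` is an `H`-umbilical point with values `lam`, `mu`: for some orthonormal basis
`e` of the tangent space at `p` and a distinguished index `a` (the index `1` of the usual notation),
`σ(e_a, e_a) = lam J e_a`, `σ(e_j, e_j) = mu J e_a`, `σ(e_a, e_j) = mu J e_j`, and `σ(e_j, e_k) = 0`
for distinct indices `j, k` different from `a`. -/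
def IsHUmbilicalPoint (g : RiemMetric E M) (h : RiemMetric F N) (𝒥 : AlmostComplex F N)
    (f : M → N) (p : M) (lam mu : ℝ) : Prop :=
  ∃ (e : Fin (Module.finrank ℝ E) → TangentSpace 𝓘(ℝ, E) p) (a : Fin (Module.finrank ℝ E)),
    OrthonormalAt g p e ∧
    secondFundamentalForm g h f p (e a) (e a)
      = lam • 𝒥.J (f p) (mfderiv 𝓘(ℝ, E) 𝓘(ℝ, F) f p (e a)) ∧
    (∀ j, j ≠ a → secondFundamentalForm g h f p (e j) (e j)
      = mu • 𝒥.J (f p) (mfderiv 𝓘(ℝ, E) 𝓘(ℝ, F) f p (e a))) ∧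
    (∀ j, j ≠ a → secondFundamentalForm g h f p (e a) (e j)
      = mu • 𝒥.J (f p) (mfderiv 𝓘(ℝ, E) 𝓘(ℝ, F) f p (e j))) ∧
    (∀ j k, j ≠ a → k ≠ a → j ≠ k → secondFundamentalForm g h f p (e j) (e k) = 0)

end Submanifold

end KaehlerGeometry

end

noncomputable section

namespace KaehlerGeometry

/-! ### Product rules for operator-valued maps. -/

section Calculus

/-! For a Lagrangian submanifold of a Kaehler manifold the cubic form T_ijk = ⟨σ(e_i, e_j), J e_k⟩
is totally symmetric: differentiate ⟨J df v, df w⟩ = 0 and use ∇J = 0 (`lagrangian_symm`).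
Polarization turns constant holomorphic curvature into a formula for all ambient sectional
curvatures (`sectional_of_holomorphic_sectional`), whose term 3⟨u, Jv⟩² vanishes on tangent vectors
of M. The Gauss equation then gives Ric(e_a) = (n-1)c/4 + ∑_{j,k} (T_jjk T_aak - T_jak²).

The rest is algebra (`symmetric_tensor_estimate`). Put τ_k = ∑_j T_jjk, so that ∑ τ_k² = n²‖H‖². Of
the squares keep only T_aak², and for j ≠ a also T_jaa² = T_aaj² and T_jaj² = T_jja². For k ≠ a
there remains τ_k T_aak - 2 T_aak² ≤ τ_k²/8. For k = a, Cauchy-Schwarz and completion of the square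
give at most (n-1)/(4n) τ_a². Since 1/8 ≤ (n-1)/(4n) for n ≥ 2, the inequality follows.

If equality holds in all directions, every defect vanishes. For n > 2 the inequality between the two
constants is strict, which forces τ = 0, then T_aaa = 0 for every unit vector, and σ = 0 by
polarization. For n = 2 the constants agree; in a frame with e_b chosen so that τ_b = 0, the
vanishing defects determine T and give the H-umbilical form with λ = 3μ. -/

theorem two_le_infty : (2 : WithTop ℕ∞) ≤ ∞ :=
  WithTop.coe_le_coe.2 (le_top : (2 : ℕ∞) ≤ ⊤)

variable {X V W Z : Type*} [NormedAddCommGroup X] [NormedSpace ℝ X]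
  [NormedAddCommGroup V] [NormedSpace ℝ V] [NormedAddCommGroup W] [NormedSpace ℝ W]
  [NormedAddCommGroup Z] [NormedSpace ℝ Z]

theorem fderiv_clm_apply_apply {B : X → V →L[ℝ] Z} {a : X → V} {x : X}
    (hB : DifferentiableAt ℝ B x) (ha : DifferentiableAt ℝ a x) (u : X) :
    fderiv ℝ (fun y => B y (a y)) x u = fderiv ℝ B x u (a x) + B x (fderiv ℝ a x u) := by
  rw [(hB.hasFDerivAt.clm_apply ha.hasFDerivAt).fderiv]
  simp [add_comm]

theorem fderiv_clm_apply₂_apply {B : X → V →L[ℝ] W →L[ℝ] Z} {a : X → V} {b : X → W} {x : X}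
    (hB : DifferentiableAt ℝ B x) (ha : DifferentiableAt ℝ a x) (hb : DifferentiableAt ℝ b x)
    (u : X) :
    fderiv ℝ (fun y => B y (a y) (b y)) x u =
      fderiv ℝ B x u (a x) (b x) + B x (fderiv ℝ a x u) (b x) + B x (a x) (fderiv ℝ b x u) := by
  rw [fderiv_clm_apply_apply (hB.clm_apply ha) hb, fderiv_clm_apply_apply hB ha]
  simp

end Calculus

/-! ### The Levi-Civita connection and its curvature in coordinates. -/

section LocalMetric

variable {E : Type*} [NormedAddCommGroup E] [NormedSpace ℝ E]

/-- `G` is a smooth Riemannian metric on the open set `U` of the coordinate space `E`. -/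
structure IsLocalMetric (G : E → E →L[ℝ] E →L[ℝ] ℝ) (U : Set E) : Prop where
  isOpen : IsOpen U
  contDiffAt : ∀ y ∈ U, ContDiffAt ℝ ∞ G y
  symm : ∀ y ∈ U, ∀ u v, G y u v = G y v u
  pos : ∀ y ∈ U, ∀ u, u ≠ 0 → 0 < G y u u

/-- Definiteness gives injectivity, and the dual has the same dimension. As
`ContinuousLinearMap.inverse` is zero on non-invertible maps, this is what makes `christoffel` and
`sharp` meaningful. -/
theorem isInvertible_of_pos [FiniteDimensional ℝ E] {B : E →L[ℝ] E →L[ℝ] ℝ}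
    (h : ∀ u, u ≠ 0 → 0 < B u u) : B.IsInvertible := by
  have hinj : Function.Injective (B : E →ₗ[ℝ] (E →L[ℝ] ℝ)) := by
    rw [← LinearMap.ker_eq_bot, LinearMap.ker_eq_bot']
    intro u hu
    by_contra hne
    have h1 := h u hne
    have h2 : B u = 0 := hu
    simp [h2] at h1
  have hfin : Module.finrank ℝ E = Module.finrank ℝ (E →L[ℝ] ℝ) := by
    rw [← (LinearMap.toContinuousLinearMap (𝕜 := ℝ) (E := E) (F' := ℝ)).finrank_eq]
    exact Subspace.dual_finrank_eq.symm
  refine ⟨(LinearEquiv.ofInjectiveOfFinrankEq (B : E →ₗ[ℝ] (E →L[ℝ] ℝ)) hinj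
    hfin).toContinuousLinearEquiv, ?_⟩
  ext u v
  change (LinearEquiv.ofInjectiveOfFinrankEq (B : E →ₗ[ℝ] (E →L[ℝ] ℝ)) hinj hfin) u v = B u v
  rw [← LinearEquiv.coe_coe, LinearEquiv.coe_ofInjectiveOfFinrankEq]
  rfl

/-- A vector is determined by its products for a positive definite form. -/
theorem eq_of_forall_pairing {B : E →L[ℝ] E →L[ℝ] ℝ} (h : ∀ u, u ≠ 0 → 0 < B u u) {a b : E}
    (hab : ∀ w, B a w = B b w) : a = b := by
  by_contra hne
  have h1 := h (a - b) (sub_ne_zero.2 hne)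
  have h2 := hab (a - b)
  simp only [map_sub, sub_apply] at h1 h2
  linarith

theorem curvatureOp_antisymm (G : E → E →L[ℝ] E →L[ℝ] ℝ) (x u v w : E) :
    curvatureOp G x u v w = - curvatureOp G x v u w := by
  simp only [curvatureOp]; abel

namespace IsLocalMetric

variable {G : E → E →L[ℝ] E →L[ℝ] ℝ} {U : Set E}

theorem differentiableAt (hG : IsLocalMetric G U) {y : E} (hy : y ∈ U) : DifferentiableAt ℝ G y :=
  (hG.contDiffAt y hy).differentiableAt (by simp)

theorem fderiv_symm (hG : IsLocalMetric G U) {y : E} (hy : y ∈ U) (u v w : E) :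
    fderiv ℝ G y u v w = fderiv ℝ G y u w v := by
  have h1 := fderiv_clm_apply₂_apply (hG.differentiableAt hy) (differentiableAt_const v)
    (differentiableAt_const w) u
  have h2 := fderiv_clm_apply₂_apply (hG.differentiableAt hy) (differentiableAt_const w)
    (differentiableAt_const v) u
  have h3 : (fun z => G z v w) =ᶠ[nhds y] fun z => G z w v := by
    filter_upwards [hG.isOpen.mem_nhds hy] with z hz using hG.symm z hz v w
  rw [h3.fderiv_eq] at h1
  simp only [fderiv_fun_const, Pi.zero_apply, zero_apply, map_zero,
    add_zero] at h1 h2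
  exact h1.symm.trans h2

variable [FiniteDimensional ℝ E]

theorem apply_christoffel (hG : IsLocalMetric G U) {y : E} (hy : y ∈ U) (u v w : E) :
    G y (christoffel G y u v) w = christoffelFirst G y u v w := by
  rw [christoffel_apply, (isInvertible_of_pos (hG.pos y hy)).self_apply_inverse]

theorem christoffel_symm (hG : IsLocalMetric G U) {y : E} (hy : y ∈ U) (u v : E) :
    christoffel G y u v = christoffel G y v u := by
  apply eq_of_forall_pairing (hG.pos y hy)
  intro w
  rw [hG.apply_christoffel hy, hG.apply_christoffel hy, christoffelFirst_apply,
    christoffelFirst_apply, hG.fderiv_symm hy w u v]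
  ring

/-- The Levi-Civita connection is compatible with the metric. -/
theorem fderiv_apply (hG : IsLocalMetric G U) {y : E} (hy : y ∈ U) (u v w : E) :
    fderiv ℝ G y u v w = G y (christoffel G y u v) w + G y v (christoffel G y u w) := by
  -- In the sum of the Christoffel symbols at (u, v, w) and (u, w, v) everything cancels except ∂_u
  -- G(v, w).
  rw [hG.symm y hy v, hG.apply_christoffel hy, hG.apply_christoffel hy, christoffelFirst_apply,
    christoffelFirst_apply, hG.fderiv_symm hy w u v, hG.fderiv_symm hy v u w,
    hG.fderiv_symm hy u w v]
  ring

theorem contDiffAt_christoffel (hG : IsLocalMetric G U) {y : E} (hy : y ∈ U) :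
    ContDiffAt ℝ ∞ (christoffel G) y := by
  have hfd : ContDiffAt ℝ ∞ (fderiv ℝ G) y := (hG.contDiffAt y hy).fderiv_right (by simp)
  have hflip : ContDiffAt ℝ ∞ (fun z => (fderiv ℝ G z).flip) y :=
    (ContinuousLinearMap.flipₗᵢ ℝ E E (E →L[ℝ] ℝ)).contDiff.contDiffAt.comp y hfd
  have hlast : ContDiffAt ℝ ∞ (derivLast G) y := contDiffAt_const.clm_comp hflip
  have h1 : ContDiffAt ℝ ∞ (christoffelFirst G) y :=
    ((hfd.add hflip).sub hlast).const_smul (1 / 2 : ℝ)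
  have h2 : ContDiffAt ℝ ∞ (fun z => (G z).inverse) y :=
    ((isInvertible_of_pos (hG.pos y hy)).contDiffAt_map_inverse).comp y (hG.contDiffAt y hy)
  exact ((ContinuousLinearMap.compL ℝ E (E →L[ℝ] ℝ) E).contDiff.contDiffAt.comp y h2).clm_comp h1

theorem differentiableAt_christoffel (hG : IsLocalMetric G U) {y : E} (hy : y ∈ U) :
    DifferentiableAt ℝ (christoffel G) y :=
  (hG.contDiffAt_christoffel hy).differentiableAt (by simp)

/-- The derivative of the product of two fields, in terms of covariant derivatives. -/
theorem fderiv_pairing (hG : IsLocalMetric G U) {X : Type*} [NormedAddCommGroup X]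
    [NormedSpace ℝ X] {φ : X → E} {a b : X → E} {x : X} (hx : φ x ∈ U)
    (hφ : DifferentiableAt ℝ φ x) (ha : DifferentiableAt ℝ a x) (hb : DifferentiableAt ℝ b x)
    (u : X) :
    fderiv ℝ (fun y => G (φ y) (a y) (b y)) x u =
      G (φ x) (fderiv ℝ a x u + christoffel G (φ x) (fderiv ℝ φ x u) (a x)) (b x)
      + G (φ x) (a x) (fderiv ℝ b x u + christoffel G (φ x) (fderiv ℝ φ x u) (b x)) := by
  have hGφ : DifferentiableAt ℝ (fun y => G (φ y)) x :=
    (hG.differentiableAt hx).comp x hφ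
  rw [fderiv_clm_apply₂_apply hGφ ha hb]
  have h1 : fderiv ℝ (fun y => G (φ y)) x u = fderiv ℝ G (φ x) (fderiv ℝ φ x u) := by
    have := fderiv_comp x (hG.differentiableAt hx) hφ
    rw [Function.comp_def] at this
    rw [this]; rfl
  rw [h1, hG.fderiv_apply hx]
  simp only [map_add, add_apply]
  ring

theorem fderiv_christoffel_apply (hG : IsLocalMetric G U) {y : E} (hy : y ∈ U) (z u v : E) :
    fderiv ℝ (fun y => christoffel G y u v) y z = fderiv ℝ (christoffel G) y z u v := by
  rw [fderiv_clm_apply₂_apply (hG.differentiableAt_christoffel hy) (differentiableAt_const u)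
    (differentiableAt_const v)]
  simp

/-- Γ is symmetric on a whole neighbourhood, so its derivative is symmetric in the last two slots as
well, and the cyclic sum cancels in pairs. -/
theorem curvatureOp_bianchi (hG : IsLocalMetric G U) {x : E} (hx : x ∈ U) (u v w : E) :
    curvatureOp G x u v w + curvatureOp G x v w u + curvatureOp G x w u v = 0 := by
  have hd : ∀ z u v, fderiv ℝ (christoffel G) x z u v = fderiv ℝ (christoffel G) x z v u := by
    intro z u v
    rw [← hG.fderiv_christoffel_apply hx, ← hG.fderiv_christoffel_apply hx]
    have h3 : (fun y => christoffel G y u v) =ᶠ[nhds x] fun y => christoffel G y v u := by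
      filter_upwards [hG.isOpen.mem_nhds hx] with y hy using hG.christoffel_symm hy u v
    rw [h3.fderiv_eq]
  simp only [curvatureOp]
  rw [hd u v w, hd v u w, hd w u v, hG.christoffel_symm hx v w, hG.christoffel_symm hx w u,
    hG.christoffel_symm hx u v]
  abel

/-- Metric compatibility expresses ∂_u ∂_v G(w, z) through covariant derivatives. Antisymmetrizing
in u, v kills the second derivative and leaves ⟨R(u,v)w, z⟩ + ⟨w, R(u,v)z⟩ = 0. -/
theorem curvatureOp_skew (hG : IsLocalMetric G U) {x : E} (hx : x ∈ U) (u v w z : E) :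
    G x (curvatureOp G x u v w) z = - G x w (curvatureOp G x u v z) := by
  have hdd : DifferentiableAt ℝ (fderiv ℝ G) x :=
    ((hG.contDiffAt x hx).fderiv_right (m := ∞) (by simp)).differentiableAt (by simp)
  have key : ∀ u v, fderiv ℝ (fderiv ℝ G) x u v w z =
      G x (fderiv ℝ (christoffel G) x u v w + christoffel G x u (christoffel G x v w)) z
      + G x (christoffel G x v w) (christoffel G x u z)
      + G x (christoffel G x u w) (christoffel G x v z)
      + G x w (fderiv ℝ (christoffel G) x u v z + christoffel G x u (christoffel G x v z)) := by
    intro u v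
    have e1 : fderiv ℝ (fun y => fderiv ℝ G y v w z) x u = fderiv ℝ (fderiv ℝ G) x u v w z := by
      rw [fderiv_clm_apply₂_apply (B := fun y => fderiv ℝ G y v) (a := fun _ => w)
        (b := fun _ => z) (hdd.clm_apply (differentiableAt_const v)) (differentiableAt_const w)
        (differentiableAt_const z), fderiv_clm_apply_apply hdd (differentiableAt_const v)]
      simp
    have e2 : (fun y => fderiv ℝ G y v w z) =ᶠ[nhds x] fun y =>
        G y (christoffel G y v w) z + G y w (christoffel G y v z) := by
      filter_upwards [hG.isOpen.mem_nhds hx] with y hy using hG.fderiv_apply hy v w z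
    have hΓ := hG.differentiableAt_christoffel hx
    have dΓ : ∀ a b, DifferentiableAt ℝ (fun y => christoffel G y a b) x := fun a b =>
      (hΓ.clm_apply (differentiableAt_const a)).clm_apply (differentiableAt_const b)
    have hGd := hG.differentiableAt hx
    rw [← e1, e2.fderiv_eq, fderiv_fun_add
      ((hGd.clm_apply (dΓ v w)).clm_apply (differentiableAt_const z))
      ((hGd.clm_apply (differentiableAt_const w)).clm_apply (dΓ v z)),
      add_apply,
      hG.fderiv_pairing (φ := fun y => y) hx differentiableAt_fun_id (dΓ v w)
        (differentiableAt_const z),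
      hG.fderiv_pairing (φ := fun y => y) hx differentiableAt_fun_id (differentiableAt_const w)
        (dΓ v z), hG.fderiv_christoffel_apply hx, hG.fderiv_christoffel_apply hx]
    simp only [fderiv_fun_const, Pi.zero_apply, zero_apply, zero_add,
      fderiv_fun_id, ContinuousLinearMap.id_apply]
    ring
  have hsymm : fderiv ℝ (fderiv ℝ G) x u v = fderiv ℝ (fderiv ℝ G) x v u :=
    (hG.contDiffAt x hx).isSymmSndFDerivAt (by simpa using two_le_infty) u v
  have k1 := key u v
  have k2 := key v u
  rw [hsymm] at k1
  simp only [curvatureOp]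
  simp only [map_add, map_sub, add_apply, sub_apply]
    at k1 k2 ⊢
  linarith

/-- The curvature operator of a Kaehler metric is complex linear. -/
theorem curvatureOp_complex (hG : IsLocalMetric G U) {J : E → E →L[ℝ] E}
    (hJ : ∀ y ∈ U, ContDiffAt ℝ ∞ J y)
    (hpar : ∀ y ∈ U, ∀ u v, fderiv ℝ J y u v + christoffel G y u (J y v) =
      J y (christoffel G y u v)) {x : E} (hx : x ∈ U) (u v w : E) :
    curvatureOp G x u v (J x w) = J x (curvatureOp G x u v w) := by
  have hdd : DifferentiableAt ℝ (fderiv ℝ J) x :=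
    ((hJ x hx).fderiv_right (m := ∞) (by simp)).differentiableAt (by simp)
  have hJd : DifferentiableAt ℝ J x := (hJ x hx).differentiableAt (by simp)
  have hΓ := hG.differentiableAt_christoffel hx
  have dΓ : ∀ a b, DifferentiableAt ℝ (fun y => christoffel G y a b) x := fun a b =>
      (hΓ.clm_apply (differentiableAt_const a)).clm_apply (differentiableAt_const b)
  have dJ : ∀ a, DifferentiableAt ℝ (fun y => J y a) x := fun a =>
    hJd.clm_apply (differentiableAt_const a)
  have fJ : ∀ u a, fderiv ℝ (fun y => J y a) x u =
      J x (christoffel G x u a) - christoffel G x u (J x a) := by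
    intro u a
    rw [fderiv_clm_apply_apply hJd (differentiableAt_const a), ← hpar x hx]
    simp
  -- The equation ∇J = 0 holds on the open set U, so it may be differentiated along u. The second
  -- derivative of J is symmetric and drops out on antisymmetrization.
  have key : ∀ u v, fderiv ℝ (fderiv ℝ J) x u v w
      + fderiv ℝ (christoffel G) x u v (J x w) + christoffel G x v (J x (christoffel G x u w))
      - christoffel G x v (christoffel G x u (J x w)) =
      J x (christoffel G x u (christoffel G x v w)) - christoffel G x u (J x (christoffel G x v w))
      + J x (fderiv ℝ (christoffel G) x u v w) := by
    intro u v
    have e2 : (fun y => fderiv ℝ J y v w + christoffel G y v (J y w)) =ᶠ[nhds x] fun y =>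
        J y (christoffel G y v w) := by
      filter_upwards [hG.isOpen.mem_nhds hx] with y hy using hpar y hy v w
    have e3 := congrArg (fun T : E →L[ℝ] E => T u) e2.fderiv_eq
    rw [fderiv_fun_add
      ((hdd.clm_apply (differentiableAt_const v)).clm_apply (differentiableAt_const w))
      ((hΓ.clm_apply (differentiableAt_const v)).clm_apply (dJ w)),
      add_apply, fderiv_clm_apply₂_apply hΓ (differentiableAt_const v) (dJ w),
      fderiv_clm_apply₂_apply hdd (differentiableAt_const v) (differentiableAt_const w),
      fderiv_clm_apply_apply hJd (dΓ v w), fJ, hG.fderiv_christoffel_apply hx] at e3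
    have hp := hpar x hx u (christoffel G x v w)
    rw [← eq_sub_iff_add_eq] at hp
    rw [hp] at e3
    simp only [fderiv_fun_const, Pi.zero_apply, zero_apply, map_zero, add_zero,
      map_sub] at e3
    rw [← e3]
    abel
  have hsymm : fderiv ℝ (fderiv ℝ J) x u v = fderiv ℝ (fderiv ℝ J) x v u :=
    (hJ x hx).isSymmSndFDerivAt (by simpa using two_le_infty) u v
  have k1 := key u v
  have k2 := key v u
  rw [hsymm] at k1
  simp only [curvatureOp, map_add, map_sub]
  have k3 := congrArg₂ (· - ·) k1 k2
  rw [← sub_eq_zero] at k3 ⊢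
  rw [← k3]
  abel

end IsLocalMetric

end LocalMetric

/-! ### Isometric immersions in coordinates: Gauss formula, Gauss equation, Lagrangian symmetry. -/

section LocalImmersion

variable {E F : Type*} [NormedAddCommGroup E] [NormedSpace ℝ E]
  [NormedAddCommGroup F] [NormedSpace ℝ F]

/-- `φ` is a smooth isometric immersion of `(U, G)` into `(W, H)`, in coordinates. -/
structure IsLocalImmersion (G : E → E →L[ℝ] E →L[ℝ] ℝ) (U : Set E)
    (H : F → F →L[ℝ] F →L[ℝ] ℝ) (W : Set F) (φ : E → F) : Prop where
  source : IsLocalMetric G U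
  target : IsLocalMetric H W
  contDiffAt : ∀ y ∈ U, ContDiffAt ℝ ∞ φ y
  mapsTo : ∀ y ∈ U, φ y ∈ W
  isometric : ∀ y ∈ U, ∀ u v, H (φ y) (fderiv ℝ φ y u) (fderiv ℝ φ y v) = G y u v

/-- The covariant derivative along `φ` of the field `φ_* v` in the direction `u`. -/
def ambientDeriv (H : F → F →L[ℝ] F →L[ℝ] ℝ) (φ : E → F) (y u v : E) : F :=
  fderiv ℝ (fderiv ℝ φ) y u v + christoffel H (φ y) (fderiv ℝ φ y u) (fderiv ℝ φ y v)

/-- The second fundamental form in coordinates. -/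
def localSecondForm (G : E → E →L[ℝ] E →L[ℝ] ℝ) (H : F → F →L[ℝ] F →L[ℝ] ℝ) (φ : E → F)
    (y u v : E) : F :=
  ambientDeriv H φ y u v - fderiv ℝ φ y (christoffel G y u v)

theorem ambientDeriv_eq (G : E → E →L[ℝ] E →L[ℝ] ℝ) (H : F → F →L[ℝ] F →L[ℝ] ℝ) (φ : E → F)
    (y u v : E) : ambientDeriv H φ y u v =
      fderiv ℝ φ y (christoffel G y u v) + localSecondForm G H φ y u v := by
  rw [localSecondForm]; abel

namespace IsLocalImmersion

variable {G : E → E →L[ℝ] E →L[ℝ] ℝ} {U : Set E} {H : F → F →L[ℝ] F →L[ℝ] ℝ} {W : Set F}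
  {φ : E → F}

theorem differentiableAt (h : IsLocalImmersion G U H W φ) {y : E} (hy : y ∈ U) :
    DifferentiableAt ℝ φ y := (h.contDiffAt y hy).differentiableAt (by simp)

theorem contDiffAt_fderiv (h : IsLocalImmersion G U H W φ) {y : E} (hy : y ∈ U) :
    ContDiffAt ℝ ∞ (fderiv ℝ φ) y := (h.contDiffAt y hy).fderiv_right (by simp)

theorem differentiableAt_fderiv (h : IsLocalImmersion G U H W φ) {y : E} (hy : y ∈ U) :
    DifferentiableAt ℝ (fderiv ℝ φ) y := (h.contDiffAt_fderiv hy).differentiableAt (by simp)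

theorem differentiableAt_fderiv_fderiv (h : IsLocalImmersion G U H W φ) {y : E} (hy : y ∈ U) :
    DifferentiableAt ℝ (fderiv ℝ (fderiv ℝ φ)) y :=
  ((h.contDiffAt_fderiv hy).fderiv_right (m := ∞) (by simp)).differentiableAt (by simp)

theorem fderiv_fderiv_apply (h : IsLocalImmersion G U H W φ) {y : E} (hy : y ∈ U) (u v : E) :
    fderiv ℝ (fun y => fderiv ℝ φ y v) y u = fderiv ℝ (fderiv ℝ φ) y u v := by
  rw [fderiv_clm_apply_apply (h.differentiableAt_fderiv hy) (differentiableAt_const v)]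
  simp

theorem fderiv_fderiv_symm (h : IsLocalImmersion G U H W φ) {y : E} (hy : y ∈ U) (u v : E) :
    fderiv ℝ (fderiv ℝ φ) y u v = fderiv ℝ (fderiv ℝ φ) y v u :=
  (h.contDiffAt y hy).isSymmSndFDerivAt (by simpa using two_le_infty) u v

variable [FiniteDimensional ℝ F]

theorem ambientDeriv_symm (h : IsLocalImmersion G U H W φ) {y : E} (hy : y ∈ U) (u v : E) :
    ambientDeriv H φ y u v = ambientDeriv H φ y v u := by
  rw [ambientDeriv, ambientDeriv, h.fderiv_fderiv_symm hy,
    h.target.christoffel_symm (h.mapsTo y hy)]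

theorem differentiableAt_ambientDeriv (h : IsLocalImmersion G U H W φ) {y : E} (hy : y ∈ U)
    (u v : E) : DifferentiableAt ℝ (fun y => ambientDeriv H φ y u v) y :=
  (((h.differentiableAt_fderiv_fderiv hy).clm_apply (differentiableAt_const u)).clm_apply
    (differentiableAt_const v)).add
    ((((h.target.differentiableAt_christoffel (h.mapsTo y hy)).comp y
      (h.differentiableAt hy)).clm_apply
      ((h.differentiableAt_fderiv hy).clm_apply (differentiableAt_const u))).clm_apply
      ((h.differentiableAt_fderiv hy).clm_apply (differentiableAt_const v)))

theorem fderiv_pairing_ambient (h : IsLocalImmersion G U H W φ) {y : E} (hy : y ∈ U) {a : E → F}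
    (ha : DifferentiableAt ℝ a y) (u w : E) :
    fderiv ℝ (fun y => H (φ y) (a y) (fderiv ℝ φ y w)) y u =
      H (φ y) (fderiv ℝ a y u + christoffel H (φ y) (fderiv ℝ φ y u) (a y)) (fderiv ℝ φ y w)
      + H (φ y) (a y) (ambientDeriv H φ y u w) := by
  rw [h.target.fderiv_pairing (h.mapsTo y hy) (h.differentiableAt hy) ha
    ((h.differentiableAt_fderiv hy).clm_apply (differentiableAt_const w)),
    h.fderiv_fderiv_apply hy]
  rfl

/-- The antisymmetrized second covariant derivative along `φ` is the ambient curvature. -/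
theorem ambient_curvature (h : IsLocalImmersion G U H W φ) {x : E} (hx : x ∈ U) (u v w : E) :
    (fderiv ℝ (fun y => ambientDeriv H φ y v w) x u
        + christoffel H (φ x) (fderiv ℝ φ x u) (ambientDeriv H φ x v w))
      - (fderiv ℝ (fun y => ambientDeriv H φ y u w) x v
        + christoffel H (φ x) (fderiv ℝ φ x v) (ambientDeriv H φ x u w))
      = curvatureOp H (φ x) (fderiv ℝ φ x u) (fderiv ℝ φ x v) (fderiv ℝ φ x w) := by
  have hd1 := h.differentiableAt_fderiv hx
  have hd2 := h.differentiableAt_fderiv_fderiv hx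
  have hΓ := h.target.differentiableAt_christoffel (h.mapsTo x hx)
  have dφ : ∀ a, DifferentiableAt ℝ (fun y => fderiv ℝ φ y a) x := fun a =>
    hd1.clm_apply (differentiableAt_const a)
  have hΓφ : DifferentiableAt ℝ (fun y => christoffel H (φ y)) x :=
    hΓ.comp x (h.differentiableAt hx)
  have fΓ : ∀ u, fderiv ℝ (fun y => christoffel H (φ y)) x u =
      fderiv ℝ (christoffel H) (φ x) (fderiv ℝ φ x u) := by
    intro u
    have := fderiv_comp x hΓ (h.differentiableAt hx)
    rw [Function.comp_def] at this
    rw [this]; rfl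
  have key : ∀ u v, fderiv ℝ (fun y => ambientDeriv H φ y v w) x u =
      fderiv ℝ (fderiv ℝ (fderiv ℝ φ)) x u v w
      + (fderiv ℝ (christoffel H) (φ x) (fderiv ℝ φ x u) (fderiv ℝ φ x v) (fderiv ℝ φ x w)
        + christoffel H (φ x) (fderiv ℝ (fderiv ℝ φ) x u v) (fderiv ℝ φ x w)
        + christoffel H (φ x) (fderiv ℝ φ x v) (fderiv ℝ (fderiv ℝ φ) x u w)) := by
    intro u v
    unfold ambientDeriv
    rw [fderiv_fun_add
      ((hd2.clm_apply (differentiableAt_const v)).clm_apply (differentiableAt_const w))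
      ((hΓφ.clm_apply (dφ v)).clm_apply (dφ w)), add_apply,
      fderiv_clm_apply₂_apply hd2 (differentiableAt_const v) (differentiableAt_const w),
      fderiv_clm_apply₂_apply hΓφ (dφ v) (dφ w), fΓ, h.fderiv_fderiv_apply hx,
      h.fderiv_fderiv_apply hx]
    simp
  -- Third derivatives of φ cancel by symmetry in the first two slots; only curvature terms survive.
  have hsymm : fderiv ℝ (fderiv ℝ (fderiv ℝ φ)) x u v = fderiv ℝ (fderiv ℝ (fderiv ℝ φ)) x v u :=
    (h.contDiffAt_fderiv hx).isSymmSndFDerivAt (by simpa using two_le_infty) u v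
  rw [key, key, hsymm, h.fderiv_fderiv_symm hx v u]
  simp only [curvatureOp, ambientDeriv, map_add]
  abel

/-- Koszul's argument. The difference of the two sides is symmetric in u, v by torsion-freeness and
skew in v, w by differentiating the isometry condition; such a trilinear form is zero. -/
theorem pairing_ambientDeriv [FiniteDimensional ℝ E] (h : IsLocalImmersion G U H W φ) {y : E} (hy : y ∈ U) (u v w : E) :
    H (φ y) (ambientDeriv H φ y u v) (fderiv ℝ φ y w) = G y (christoffel G y u v) w := by
  have key : ∀ u v w, H (φ y) (ambientDeriv H φ y u v) (fderiv ℝ φ y w)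
      + H (φ y) (ambientDeriv H φ y u w) (fderiv ℝ φ y v)
      = G y (christoffel G y u v) w + G y (christoffel G y u w) v := by
    intro u v w
    have e : (fun y => H (φ y) (fderiv ℝ φ y v) (fderiv ℝ φ y w)) =ᶠ[nhds y]
        fun y => G y v w := by
      filter_upwards [h.source.isOpen.mem_nhds hy] with z hz using h.isometric z hz v w
    have e1 := congrArg (fun T : E →L[ℝ] ℝ => T u) e.fderiv_eq
    rw [h.fderiv_pairing_ambient hy
      ((h.differentiableAt_fderiv hy).clm_apply (differentiableAt_const v)),
      h.fderiv_fderiv_apply hy, fderiv_clm_apply₂_apply (h.source.differentiableAt hy)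
        (differentiableAt_const v) (differentiableAt_const w), h.source.fderiv_apply hy] at e1
    simp only [fderiv_fun_const, Pi.zero_apply, zero_apply, map_zero, add_zero] at e1
    rw [h.source.symm y hy v] at e1
    rw [← e1, h.target.symm _ (h.mapsTo y hy) (fderiv ℝ φ y v)]
    rfl
  have k1 := key u v w
  have k2 := key v w u
  have k3 := key w u v
  rw [h.ambientDeriv_symm hy v w, h.ambientDeriv_symm hy v u, h.source.christoffel_symm hy v w,
    h.source.christoffel_symm hy v u] at k2
  rw [h.ambientDeriv_symm hy w u, h.source.christoffel_symm hy w u] at k3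
  linarith

theorem pairing_localSecondForm [FiniteDimensional ℝ E] (h : IsLocalImmersion G U H W φ) {y : E} (hy : y ∈ U)
    (u v w : E) : H (φ y) (localSecondForm G H φ y u v) (fderiv ℝ φ y w) = 0 := by
  rw [localSecondForm, map_sub, sub_apply, h.pairing_ambientDeriv hy, h.isometric y hy, sub_self]

theorem localSecondForm_symm [FiniteDimensional ℝ E] (h : IsLocalImmersion G U H W φ) {y : E} (hy : y ∈ U) (u v : E) :
    localSecondForm G H φ y u v = localSecondForm G H φ y v u := by
  rw [localSecondForm, localSecondForm, h.ambientDeriv_symm hy, h.source.christoffel_symm hy]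

theorem pairing_ambientDeriv_ambientDeriv [FiniteDimensional ℝ E] (h : IsLocalImmersion G U H W φ) {y : E} (hy : y ∈ U)
    (u v w z : E) :
    H (φ y) (ambientDeriv H φ y u v) (ambientDeriv H φ y w z) =
      G y (christoffel G y u v) (christoffel G y w z)
      + H (φ y) (localSecondForm G H φ y u v) (localSecondForm G H φ y w z) := by
  rw [ambientDeriv_eq G H φ y w z, map_add, h.pairing_ambientDeriv hy, ambientDeriv_eq G H φ y u v,
    map_add, add_apply, h.target.symm _ (h.mapsTo y hy) (fderiv ℝ φ y _),
    h.pairing_localSecondForm hy, zero_add]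

/-- The Gauss equation. -/
theorem gauss_equation [FiniteDimensional ℝ E] (h : IsLocalImmersion G U H W φ) {x : E} (hx : x ∈ U) (u v w z : E) :
    G x (curvatureOp G x u v w) z =
      H (φ x) (curvatureOp H (φ x) (fderiv ℝ φ x u) (fderiv ℝ φ x v) (fderiv ℝ φ x w))
        (fderiv ℝ φ x z)
      + H (φ x) (localSecondForm G H φ x v w) (localSecondForm G H φ x u z)
      - H (φ x) (localSecondForm G H φ x u w) (localSecondForm G H φ x v z) := by
  -- This is the derivative along u of `pairing_ambientDeriv`. The products of tangential parts
  -- agree on both sides, so only the product of two values of σ remains; antisymmetrizing in u, v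
  -- yields both curvatures.
  have key : ∀ u v, H (φ x) (fderiv ℝ (fun y => ambientDeriv H φ y v w) x u
        + christoffel H (φ x) (fderiv ℝ φ x u) (ambientDeriv H φ x v w)) (fderiv ℝ φ x z)
      + H (φ x) (localSecondForm G H φ x v w) (localSecondForm G H φ x u z)
      = G x (fderiv ℝ (christoffel G) x u v w + christoffel G x u (christoffel G x v w)) z := by
    intro u v
    have e : (fun y => H (φ y) (ambientDeriv H φ y v w) (fderiv ℝ φ y z)) =ᶠ[nhds x]
        fun y => G y (christoffel G y v w) z := by
      filter_upwards [h.source.isOpen.mem_nhds hx] with y hy using h.pairing_ambientDeriv hy v w z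
    have e1 := congrArg (fun T : E →L[ℝ] ℝ => T u) e.fderiv_eq
    have dΓ : DifferentiableAt ℝ (fun y => christoffel G y v w) x :=
      ((h.source.differentiableAt_christoffel hx).clm_apply (differentiableAt_const v)).clm_apply
        (differentiableAt_const w)
    rw [h.fderiv_pairing_ambient hx (h.differentiableAt_ambientDeriv hx v w),
      h.source.fderiv_pairing (φ := fun y => y) hx differentiableAt_fun_id dΓ
        (differentiableAt_const z), h.source.fderiv_christoffel_apply hx,
      h.pairing_ambientDeriv_ambientDeriv hx] at e1
    simp only [fderiv_fun_const, Pi.zero_apply, zero_apply, zero_add, fderiv_fun_id,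
      ContinuousLinearMap.id_apply] at e1
    linarith
  have k1 := key u v
  have k2 := key v u
  rw [← h.ambient_curvature hx]
  simp only [curvatureOp, map_add, map_sub, add_apply, sub_apply] at k1 k2 ⊢
  linarith

/-- For a Lagrangian immersion, the form `H(σ(u, v), J φ_* w)` is symmetric in `v` and `w`. -/
theorem lagrangian_symm (h : IsLocalImmersion G U H W φ) {J : F → F →L[ℝ] F}
    (hJ : ∀ y ∈ W, ContDiffAt ℝ ∞ J y)
    (hpar : ∀ y ∈ W, ∀ u v, fderiv ℝ J y u v + christoffel H y u (J y v) =
      J y (christoffel H y u v))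
    (hskew : ∀ y ∈ W, ∀ u v, H y (J y u) v = - H y u (J y v))
    (hL : ∀ y ∈ U, ∀ v w, H (φ y) (J (φ y) (fderiv ℝ φ y v)) (fderiv ℝ φ y w) = 0)
    {x : E} (hx : x ∈ U) (u v w : E) :
    H (φ x) (localSecondForm G H φ x u v) (J (φ x) (fderiv ℝ φ x w)) =
      H (φ x) (localSecondForm G H φ x u w) (J (φ x) (fderiv ℝ φ x v)) := by
  have hW := h.mapsTo x hx
  -- Differentiate the Lagrangian condition along u. J commutes with the ambient derivative, and the
  -- tangential parts disappear by the same condition.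
  have e : (fun y => H (φ y) (J (φ y) (fderiv ℝ φ y v)) (fderiv ℝ φ y w)) =ᶠ[nhds x]
      fun _ => 0 := by
    filter_upwards [h.source.isOpen.mem_nhds hx] with z hz using hL z hz v w
  have e1 := congrArg (fun T : E →L[ℝ] ℝ => T u) e.fderiv_eq
  have hJd : DifferentiableAt ℝ J (φ x) := (hJ _ hW).differentiableAt (by simp)
  have hJφ : DifferentiableAt ℝ (fun y => J (φ y)) x := hJd.comp x (h.differentiableAt hx)
  have fJ : fderiv ℝ (fun y => J (φ y)) x u = fderiv ℝ J (φ x) (fderiv ℝ φ x u) := by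
    have := fderiv_comp x hJd (h.differentiableAt hx)
    rw [Function.comp_def] at this
    rw [this]; rfl
  have dv := (h.differentiableAt_fderiv hx).clm_apply (differentiableAt_const v)
  have e2 : fderiv ℝ (fun y => J (φ y) (fderiv ℝ φ y v)) x u
      + christoffel H (φ x) (fderiv ℝ φ x u) (J (φ x) (fderiv ℝ φ x v))
      = J (φ x) (ambientDeriv H φ x u v) := by
    rw [fderiv_clm_apply_apply hJφ dv, fJ, h.fderiv_fderiv_apply hx, ambientDeriv, map_add,
      ← hpar _ hW]
    abel
  rw [h.fderiv_pairing_ambient hx (hJφ.clm_apply dv), e2, hskew _ hW,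
    ambientDeriv_eq G, ambientDeriv_eq G, map_add, add_apply, map_add, hL x hx] at e1
  have e3 := hL x hx w (christoffel G x u v)
  rw [h.target.symm _ hW] at e3
  rw [e3, h.target.symm _ hW (J (φ x) (fderiv ℝ φ x v))] at e1
  simp only [fderiv_fun_const, Pi.zero_apply, zero_apply] at e1
  linarith

end IsLocalImmersion

end LocalImmersion

/-! ### Metric and complex structure in a chart. -/

section Charts

variable {E : Type*} [NormedAddCommGroup E] [NormedSpace ℝ E]
  {M : Type*} [TopologicalSpace M] [ChartedSpace E M] [IsManifold 𝓘(ℝ, E) ∞ M]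

/-- Links the chart differential to the tangent bundle trivialization, through which smoothness of
sections is defined. -/
theorem fromChart_eq_symmL (x₀ : M) {y : E} (hy : y ∈ (extChartAt 𝓘(ℝ, E) x₀).target) :
    fromChart x₀ y = (trivializationAt E (TangentSpace 𝓘(ℝ, E)) x₀).symmL ℝ
      ((extChartAt 𝓘(ℝ, E) x₀).symm y) := by
  have : IsManifold 𝓘(ℝ, E) 1 M := IsManifold.of_le (n := ∞) (by simp)
  have hs : (extChartAt 𝓘(ℝ, E) x₀).symm y ∈ (chartAt E x₀).source := by
    simpa using (extChartAt 𝓘(ℝ, E) x₀).map_target hy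
  rw [TangentBundle.symmL_trivializationAt hs, (extChartAt 𝓘(ℝ, E) x₀).right_inv hy]
  simp only [modelWithCornersSelf_coe, Set.range_id, mfderivWithin_univ]
  rfl

theorem toChart_comp_fromChart (x₀ : M) {y : E} (hy : y ∈ (extChartAt 𝓘(ℝ, E) x₀).target) (u : E) :
    toChart x₀ y (fromChart x₀ y u) = u := by
  have : IsManifold 𝓘(ℝ, E) 1 M := IsManifold.of_le (n := ∞) (by simp)
  have h := mfderiv_extChartAt_comp_mfderivWithin_extChartAt_symm (I := 𝓘(ℝ, E)) hy
  simp only [modelWithCornersSelf_coe, Set.range_id, mfderivWithin_univ] at h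
  exact congrArg (fun T : E →L[ℝ] E => T u) h

theorem fromChart_comp_toChart (x₀ : M) {y : E} (hy : y ∈ (extChartAt 𝓘(ℝ, E) x₀).target) (u : E) :
    fromChart x₀ y (toChart x₀ y u) = u := by
  have : IsManifold 𝓘(ℝ, E) 1 M := IsManifold.of_le (n := ∞) (by simp)
  have h := mfderivWithin_extChartAt_symm_comp_mfderiv_extChartAt (I := 𝓘(ℝ, E)) hy
  simp only [modelWithCornersSelf_coe, Set.range_id, mfderivWithin_univ] at h
  exact congrArg (fun T : E →L[ℝ] E => T u) h

/-- The tangent space at x₀ is modelled on the preferred chart at x₀. Hence tensors at x₀ and their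
chart expressions at the centre coincide. -/
theorem fromChart_center (x₀ : M) (u : E) :
    fromChart x₀ (extChartAt 𝓘(ℝ, E) x₀ x₀) u = u := by
  have : IsManifold 𝓘(ℝ, E) 1 M := IsManifold.of_le (n := ∞) (by simp)
  rw [fromChart_eq_symmL x₀ (mem_extChartAt_target x₀), extChartAt_to_inv,
    TangentBundle.symmL_trivializationAt_eq_core (mem_chart_source E x₀)]
  exact (tangentBundleCore 𝓘(ℝ, E) M).coordChange_self _ _ (mem_chart_source E x₀) _

theorem toChart_center (x₀ : M) (u : E) :
    toChart x₀ (extChartAt 𝓘(ℝ, E) x₀ x₀) u = u := by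
  conv_lhs => rw [← fromChart_center x₀ u]
  exact toChart_comp_fromChart x₀ (mem_extChartAt_target x₀) u

theorem metricInChart_center (g : RiemMetric E M) (x₀ : M) (u v : E) :
    metricInChart g x₀ (extChartAt 𝓘(ℝ, E) x₀ x₀) u v = metricAt g x₀ u v := by
  change metricAt g _ (fromChart x₀ _ u) (fromChart x₀ _ v) = _
  rw [fromChart_center, fromChart_center, extChartAt_to_inv]

theorem complexInChart_center (𝒥 : AlmostComplex E M) (x₀ : M) (u : E) :
    complexInChart 𝒥 x₀ (extChartAt 𝓘(ℝ, E) x₀ x₀) u = complexAt 𝒥 x₀ u := by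
  change toChart x₀ _ (complexAt 𝒥 _ (fromChart x₀ _ u)) = _
  rw [fromChart_center, toChart_center, extChartAt_to_inv]

theorem contMDiffOn_extChartAt_symm_infty (x₀ : M) :
    ContMDiffOn 𝓘(ℝ, E) 𝓘(ℝ, E) ∞ (extChartAt 𝓘(ℝ, E) x₀).symm (extChartAt 𝓘(ℝ, E) x₀).target :=
  contMDiffOn_extChartAt_symm x₀

/-- The coordinate vector fields of a chart are smooth. -/
theorem contMDiffOn_fromChart (x₀ : M) (u : E) :
    ContMDiffOn 𝓘(ℝ, E) (𝓘(ℝ, E).prod 𝓘(ℝ, E)) ∞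
      (fun y => Bundle.TotalSpace.mk' E (E := fun q : M => TangentSpace 𝓘(ℝ, E) q)
        ((extChartAt 𝓘(ℝ, E) x₀).symm y) (fromChart x₀ y u))
      (extChartAt 𝓘(ℝ, E) x₀).target := by
  have : IsManifold 𝓘(ℝ, E) 1 M := IsManifold.of_le (n := ∞) (by simp)
  have hs : ∀ y ∈ (extChartAt 𝓘(ℝ, E) x₀).target,
      (extChartAt 𝓘(ℝ, E) x₀).symm y ∈
        (trivializationAt E (TangentSpace 𝓘(ℝ, E)) x₀).baseSet := fun y hy => by
    simpa using (extChartAt 𝓘(ℝ, E) x₀).map_target hy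
  rw [(trivializationAt E (TangentSpace 𝓘(ℝ, E)) x₀).contMDiffOn_iff
    (fun y hy => (Bundle.Trivialization.mem_source _).2 (hs y hy))]
  refine ⟨contMDiffOn_extChartAt_symm_infty x₀, ?_⟩
  -- Read in the trivialization over the same chart, a coordinate field is the constant u.
  refine contMDiffOn_const (c := u) |>.congr fun y hy => ?_
  rw [fromChart_eq_symmL x₀ hy]
  have := (trivializationAt E (TangentSpace 𝓘(ℝ, E)) x₀).continuousLinearMapAt_symmL (R := ℝ)
    (hs y hy) u
  rw [Bundle.Trivialization.continuousLinearMapAt_apply,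
    Bundle.Trivialization.coe_linearMapAt_of_mem _ (hs y hy)] at this
  exact this

theorem contDiffOn_metricInChart_apply (g : RiemMetric E M) (x₀ : M) (u v : E) :
    ContDiffOn ℝ ∞ (fun y => metricInChart g x₀ y u v) (extChartAt 𝓘(ℝ, E) x₀).target := by
  have hg := g.contMDiff.comp_contMDiffOn (contMDiffOn_extChartAt_symm_infty x₀)
  have h2 := ContMDiffOn.clm_bundle_apply₂ (F₃ := ℝ) (E₃ := Bundle.Trivial M ℝ) hg
    (contMDiffOn_fromChart x₀ u) (contMDiffOn_fromChart x₀ v)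
  rw [← contMDiffOn_iff_contDiffOn]
  intro y hy
  have h3 := h2 y hy
  rw [Bundle.contMDiffWithinAt_totalSpace] at h3
  exact h3.2

theorem contDiffAt_metricInChart [FiniteDimensional ℝ E] (g : RiemMetric E M) (x₀ : M) {y : E}
    (hy : y ∈ (extChartAt 𝓘(ℝ, E) x₀).target) : ContDiffAt ℝ ∞ (metricInChart g x₀) y := by
  have h : ContDiffOn ℝ ∞ (metricInChart g x₀) (extChartAt 𝓘(ℝ, E) x₀).target := by
    rw [contDiffOn_clm_apply]
    intro u
    rw [contDiffOn_clm_apply]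
    exact fun v => contDiffOn_metricInChart_apply g x₀ u v
  exact h.contDiffAt ((isOpen_extChartAt_target x₀).mem_nhds hy)

theorem metricAt_symm (g : RiemMetric E M) (q : M) (u v : E) : metricAt g q u v = metricAt g q v u :=
  g.symm q u v

theorem metricAt_pos (g : RiemMetric E M) (q : M) {u : E} (hu : u ≠ 0) : 0 < metricAt g q u u :=
  g.pos q u hu

theorem metricInChart_apply (g : RiemMetric E M) (x₀ : M) (y u v : E) :
    metricInChart g x₀ y u v =
      metricAt g ((extChartAt 𝓘(ℝ, E) x₀).symm y) (fromChart x₀ y u) (fromChart x₀ y v) := rfl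

theorem metricInChart_symm (g : RiemMetric E M) (x₀ : M) (y u v : E) :
    metricInChart g x₀ y u v = metricInChart g x₀ y v u := by
  rw [metricInChart_apply, metricInChart_apply, metricAt_symm]

theorem metricInChart_pos (g : RiemMetric E M) (x₀ : M) {y : E}
    (hy : y ∈ (extChartAt 𝓘(ℝ, E) x₀).target) {u : E} (hu : u ≠ 0) :
    0 < metricInChart g x₀ y u u := by
  rw [metricInChart_apply]
  refine metricAt_pos g _ fun h0 => hu ?_
  rw [← toChart_comp_fromChart x₀ hy u, h0, map_zero]

theorem isLocalMetric_metricInChart [FiniteDimensional ℝ E] (g : RiemMetric E M) (x₀ : M) :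
    IsLocalMetric (metricInChart g x₀) (extChartAt 𝓘(ℝ, E) x₀).target where
  isOpen := isOpen_extChartAt_target x₀
  contDiffAt _ hy := contDiffAt_metricInChart g x₀ hy
  symm y _ := metricInChart_symm g x₀ y
  pos _ hy _ hu := metricInChart_pos g x₀ hy hu

theorem contDiffAt_complexInChart [FiniteDimensional ℝ E] (𝒥 : AlmostComplex E M) (x₀ : M)
    {y : E}
    (hy : y ∈ (extChartAt 𝓘(ℝ, E) x₀).target) : ContDiffAt ℝ ∞ (complexInChart 𝒥 x₀) y := by
  have : IsManifold 𝓘(ℝ, E) 1 M := IsManifold.of_le (n := ∞) (by simp)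
  have hs : ∀ y ∈ (extChartAt 𝓘(ℝ, E) x₀).target,
      (extChartAt 𝓘(ℝ, E) x₀).symm y ∈ (chartAt E x₀).source := fun y hy => by
    simpa using (extChartAt 𝓘(ℝ, E) x₀).map_target hy
  suffices h : ContDiffOn ℝ ∞ (complexInChart 𝒥 x₀) (extChartAt 𝓘(ℝ, E) x₀).target from
    h.contDiffAt ((isOpen_extChartAt_target x₀).mem_nhds hy)
  rw [contDiffOn_clm_apply]
  intro u
  have hJ := 𝒥.contMDiff.comp_contMDiffOn (contMDiffOn_extChartAt_symm_infty x₀)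
  have h2 := ContMDiffOn.clm_bundle_apply (F₂ := E) hJ (contMDiffOn_fromChart x₀ u)
  rw [(trivializationAt E (TangentSpace 𝓘(ℝ, E)) x₀).contMDiffOn_iff
    (fun y hy => (Bundle.Trivialization.mem_source _).2 (by simpa using hs y hy))] at h2
  rw [← contMDiffOn_iff_contDiffOn]
  refine h2.2.congr fun y hy => ?_
  have h3 := TangentBundle.continuousLinearMapAt_trivializationAt (I := 𝓘(ℝ, E)) (hs y hy)
  have hb : (extChartAt 𝓘(ℝ, E) x₀).symm y ∈
    (trivializationAt E (TangentSpace 𝓘(ℝ, E)) x₀).baseSet := by simpa using hs y hy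
  have h4 := congrArg (fun T : E →L[ℝ] E => T (complexAt 𝒥
    ((extChartAt 𝓘(ℝ, E) x₀).symm y) (fromChart x₀ y u))) h3
  refine h4.symm.trans ?_
  exact congrFun (Bundle.Trivialization.coe_linearMapAt_of_mem (R := ℝ)
    (trivializationAt E (TangentSpace 𝓘(ℝ, E)) x₀) hb) _

theorem complexInChart_sq (𝒥 : AlmostComplex E M) (x₀ : M) {y : E}
    (hy : y ∈ (extChartAt 𝓘(ℝ, E) x₀).target) (u : E) :
    complexInChart 𝒥 x₀ y (complexInChart 𝒥 x₀ y u) = -u := by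
  change toChart x₀ y (complexAt 𝒥 _ (fromChart x₀ y (toChart x₀ y (complexAt 𝒥 _
    (fromChart x₀ y u))))) = -u
  rw [fromChart_comp_toChart x₀ hy]
  refine (congrArg (toChart x₀ y) (𝒥.sq _ _)).trans ?_
  exact (map_neg _ _).trans (congrArg _ (toChart_comp_fromChart x₀ hy u))

theorem metricInChart_complexInChart {g : RiemMetric E M} {𝒥 : AlmostComplex E M}
    (h : IsAlmostHermitian g 𝒥) (x₀ : M) {y : E} (hy : y ∈ (extChartAt 𝓘(ℝ, E) x₀).target)
    (u v : E) : metricInChart g x₀ y (complexInChart 𝒥 x₀ y u) (complexInChart 𝒥 x₀ y v) =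
      metricInChart g x₀ y u v := by
  change metricAt g _ (fromChart x₀ y (toChart x₀ y (complexAt 𝒥 _ (fromChart x₀ y u))))
    (fromChart x₀ y (toChart x₀ y (complexAt 𝒥 _ (fromChart x₀ y v)))) = _
  rw [fromChart_comp_toChart x₀ hy, fromChart_comp_toChart x₀ hy]
  exact h _ _ _

theorem metricInChart_complexInChart_skew {g : RiemMetric E M} {𝒥 : AlmostComplex E M}
    (h : IsAlmostHermitian g 𝒥) (x₀ : M) {y : E} (hy : y ∈ (extChartAt 𝓘(ℝ, E) x₀).target)
    (u v : E) : metricInChart g x₀ y (complexInChart 𝒥 x₀ y u) v =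
      - metricInChart g x₀ y u (complexInChart 𝒥 x₀ y v) := by
  rw [← metricInChart_complexInChart h x₀ hy u, complexInChart_sq 𝒥 x₀ hy, map_neg, neg_neg]

end Charts

/-! ### The coordinate expression of an immersion. -/

section Immersion

variable {E : Type*} [NormedAddCommGroup E] [NormedSpace ℝ E]
  {M : Type*} [TopologicalSpace M] [ChartedSpace E M]
  {F : Type*} [NormedAddCommGroup F] [NormedSpace ℝ F]
  {N : Type*} [TopologicalSpace N] [ChartedSpace F N]

/-- The domain of the coordinate expression of `f` at `p`. -/
def chartDomain (E F : Type*) [NormedAddCommGroup E] [NormedSpace ℝ E] [NormedAddCommGroup F]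
    [NormedSpace ℝ F] {M N : Type*} [TopologicalSpace M] [ChartedSpace E M] [TopologicalSpace N]
    [ChartedSpace F N] (f : M → N) (p : M) : Set E :=
  (extChartAt 𝓘(ℝ, E) p).target ∩
    (extChartAt 𝓘(ℝ, E) p).symm ⁻¹' (f ⁻¹' (extChartAt 𝓘(ℝ, F) (f p)).source)

/-- The differential of `f` at `p`. -/
def differential (E F : Type*) [NormedAddCommGroup E] [NormedSpace ℝ E] [NormedAddCommGroup F]
    [NormedSpace ℝ F] {M N : Type*} [TopologicalSpace M] [ChartedSpace E M] [TopologicalSpace N]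
    [ChartedSpace F N] (f : M → N) (p : M) : E →L[ℝ] F :=
  mfderiv 𝓘(ℝ, E) 𝓘(ℝ, F) f p

theorem mem_chartDomain (f : M → N) (p : M) :
    extChartAt 𝓘(ℝ, E) p p ∈ chartDomain E F f p :=
  ⟨mem_extChartAt_target p, by simp⟩

theorem isOpen_chartDomain {f : M → N} (hf : Continuous f) (p : M) :
    IsOpen (chartDomain E F f p) :=
  (continuousOn_extChartAt_symm p).isOpen_inter_preimage (isOpen_extChartAt_target p)
    ((isOpen_extChartAt_source (f p)).preimage hf)

theorem writtenInExtChartAt_mapsTo {f : M → N} {p : M} {y : E} (hy : y ∈ chartDomain E F f p) :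
    writtenInExtChartAt 𝓘(ℝ, E) 𝓘(ℝ, F) p f y ∈ (extChartAt 𝓘(ℝ, F) (f p)).target :=
  (extChartAt 𝓘(ℝ, F) (f p)).map_source hy.2

theorem extChartAt_symm_writtenInExtChartAt {f : M → N} {p : M} {y : E}
    (hy : y ∈ chartDomain E F f p) :
    (extChartAt 𝓘(ℝ, F) (f p)).symm (writtenInExtChartAt 𝓘(ℝ, E) 𝓘(ℝ, F) p f y) =
      f ((extChartAt 𝓘(ℝ, E) p).symm y) :=
  (extChartAt 𝓘(ℝ, F) (f p)).left_inv hy.2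

theorem fderiv_writtenInExtChartAt_center {f : M → N} (hf : ContMDiff 𝓘(ℝ, E) 𝓘(ℝ, F) ∞ f)
    (p : M) (u : E) :
    fderiv ℝ (writtenInExtChartAt 𝓘(ℝ, E) 𝓘(ℝ, F) p f) (extChartAt 𝓘(ℝ, E) p p) u =
      differential E F f p u := by
  have h := (hf.contMDiffAt (x := p)).mdifferentiableAt (by simp) |>.mfderiv
  simp only [modelWithCornersSelf_coe, Set.range_id, fderivWithin_univ] at h
  exact (congrArg (fun T : E →L[ℝ] F => T u) h).symm

theorem writtenInExtChartAt_center (f : M → N) (p : M) :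
    writtenInExtChartAt 𝓘(ℝ, E) 𝓘(ℝ, F) p f (extChartAt 𝓘(ℝ, E) p p) =
      extChartAt 𝓘(ℝ, F) (f p) (f p) := by
  simp [writtenInExtChartAt]

variable [IsManifold 𝓘(ℝ, E) ∞ M] [IsManifold 𝓘(ℝ, F) ∞ N]

theorem contDiffAt_writtenInExtChartAt {f : M → N} (hf : ContMDiff 𝓘(ℝ, E) 𝓘(ℝ, F) ∞ f) (p : M)
    {y : E} (hy : y ∈ chartDomain E F f p) :
    ContDiffAt ℝ ∞ (writtenInExtChartAt 𝓘(ℝ, E) 𝓘(ℝ, F) p f) y := by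
  rw [← contMDiffAt_iff_contDiffAt]
  have h1 : ContMDiffAt 𝓘(ℝ, E) 𝓘(ℝ, E) ∞ (extChartAt 𝓘(ℝ, E) p).symm y :=
    (contMDiffOn_extChartAt_symm_infty p).contMDiffAt ((isOpen_extChartAt_target p).mem_nhds hy.1)
  have h2 : ContMDiffAt 𝓘(ℝ, F) 𝓘(ℝ, F) ∞ (extChartAt 𝓘(ℝ, F) (f p))
      (f ((extChartAt 𝓘(ℝ, E) p).symm y)) :=
    (contMDiffOn_extChartAt (I := 𝓘(ℝ, F)) (x := f p)).contMDiffAt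
      ((chartAt F (f p)).open_source.mem_nhds (by simpa using hy.2))
  exact h2.comp y ((hf.contMDiffAt).comp y h1)

/-- The differential of `f`, expressed in the charts. -/
theorem fromChart_fderiv_writtenInExtChartAt {f : M → N} (hf : ContMDiff 𝓘(ℝ, E) 𝓘(ℝ, F) ∞ f)
    (p : M) {y : E} (hy : y ∈ chartDomain E F f p) (u : E) :
    fromChart (f p) (writtenInExtChartAt 𝓘(ℝ, E) 𝓘(ℝ, F) p f y)
        (fderiv ℝ (writtenInExtChartAt 𝓘(ℝ, E) 𝓘(ℝ, F) p f) y u) =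
      mfderiv 𝓘(ℝ, E) 𝓘(ℝ, F) f ((extChartAt 𝓘(ℝ, E) p).symm y) (fromChart p y u) := by
  set φ := writtenInExtChartAt 𝓘(ℝ, E) 𝓘(ℝ, F) p f with hφ
  have h1 : MDifferentiableAt 𝓘(ℝ, E) 𝓘(ℝ, E) (extChartAt 𝓘(ℝ, E) p).symm y :=
    ((contMDiffOn_extChartAt_symm_infty p).contMDiffAt
      ((isOpen_extChartAt_target p).mem_nhds hy.1)).mdifferentiableAt (by simp)
  have h2 : MDifferentiableAt 𝓘(ℝ, F) 𝓘(ℝ, F) (extChartAt 𝓘(ℝ, F) (f p)).symm (φ y) :=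
    ((contMDiffOn_extChartAt_symm_infty (f p)).contMDiffAt
      ((isOpen_extChartAt_target (f p)).mem_nhds (writtenInExtChartAt_mapsTo hy))).mdifferentiableAt
        (by simp)
  have h3 : MDifferentiableAt 𝓘(ℝ, E) 𝓘(ℝ, F) f ((extChartAt 𝓘(ℝ, E) p).symm y) :=
    hf.contMDiffAt.mdifferentiableAt (by simp)
  have h4 : MDifferentiableAt 𝓘(ℝ, E) 𝓘(ℝ, F) φ y :=
    ((contDiffAt_writtenInExtChartAt hf p hy).differentiableAt (by simp)).mdifferentiableAt
  have e : (extChartAt 𝓘(ℝ, F) (f p)).symm ∘ φ =ᶠ[nhds y] f ∘ (extChartAt 𝓘(ℝ, E) p).symm := by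
    filter_upwards [(isOpen_chartDomain hf.continuous p).mem_nhds hy] with z hz using
      extChartAt_symm_writtenInExtChartAt hz
  have e1 := e.mfderiv_eq (I := 𝓘(ℝ, E)) (I' := 𝓘(ℝ, F))
  rw [mfderiv_comp y h2 h4, mfderiv_comp y h3 h1, mfderiv_eq_fderiv] at e1
  exact congrArg (fun T : E →L[ℝ] F => T u) e1

theorem IsLagrangian.inChart {h : RiemMetric F N} {𝒥 : AlmostComplex F N} {f : M → N}
    (hL : IsLagrangian (E := E) h 𝒥 f) (hf : ContMDiff 𝓘(ℝ, E) 𝓘(ℝ, F) ∞ f) (p : M) {y : E}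
    (hy : y ∈ chartDomain E F f p) (v w : E) :
    metricInChart h (f p) (writtenInExtChartAt 𝓘(ℝ, E) 𝓘(ℝ, F) p f y)
      (complexInChart 𝒥 (f p) (writtenInExtChartAt 𝓘(ℝ, E) 𝓘(ℝ, F) p f y)
        (fderiv ℝ (writtenInExtChartAt 𝓘(ℝ, E) 𝓘(ℝ, F) p f) y v))
      (fderiv ℝ (writtenInExtChartAt 𝓘(ℝ, E) 𝓘(ℝ, F) p f) y w) = 0 := by
  change metricAt h _ (fromChart (f p) _ (toChart (f p) _ (complexAt 𝒥 _ (fromChart (f p) _ _))))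
    (fromChart (f p) _ _) = _
  rw [fromChart_comp_toChart (f p) (writtenInExtChartAt_mapsTo hy),
    fromChart_fderiv_writtenInExtChartAt hf p hy, fromChart_fderiv_writtenInExtChartAt hf p hy,
    extChartAt_symm_writtenInExtChartAt hy]
  -- Only J(TM) ⊆ normal space is needed here; the opposite inclusion enters in `isLagrangianForm`.
  have h1 := (hL ((extChartAt 𝓘(ℝ, E) p).symm y)).subset
    ⟨_, ⟨fromChart p y v, rfl⟩, rfl⟩
  exact h1 _

variable [FiniteDimensional ℝ E] [FiniteDimensional ℝ F]

theorem IsIsometricImmersion.isLocalImmersion {g : RiemMetric E M} {h : RiemMetric F N} {f : M → N}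
    (hf : IsIsometricImmersion g h f) (p : M) :
    IsLocalImmersion (metricInChart g p) (chartDomain E F f p) (metricInChart h (f p))
      (extChartAt 𝓘(ℝ, F) (f p)).target (writtenInExtChartAt 𝓘(ℝ, E) 𝓘(ℝ, F) p f) where
  source :=
    { isOpen := isOpen_chartDomain hf.contMDiff.continuous p
      contDiffAt := fun y hy => (isLocalMetric_metricInChart g p).contDiffAt y hy.1
      symm := fun y hy => (isLocalMetric_metricInChart g p).symm y hy.1
      pos := fun y hy => (isLocalMetric_metricInChart g p).pos y hy.1 }
  target := isLocalMetric_metricInChart h (f p)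
  contDiffAt _ hy := contDiffAt_writtenInExtChartAt hf.contMDiff p hy
  mapsTo _ hy := writtenInExtChartAt_mapsTo hy
  isometric y hy u v := by
    change metricAt h _ (fromChart (f p) _ _) (fromChart (f p) _ _) = _
    rw [fromChart_fderiv_writtenInExtChartAt hf.contMDiff p hy,
      fromChart_fderiv_writtenInExtChartAt hf.contMDiff p hy,
      extChartAt_symm_writtenInExtChartAt hy]
    exact hf.isometric _ _ _

end Immersion

/-! ### Algebra of Kaehler curvature tensors. -/

section CurvatureTensor

/-- A combination of the Bianchi identities at the four cyclic shifts of (x, y, z, w), rewritten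
with both antisymmetries. -/
theorem curvature_pair_symm {V : Type*} {R : V → V → V → V → ℝ}
    (anti : ∀ x y z w, R x y z w = - R y x z w)
    (skew : ∀ x y z w, R x y z w = - R x y w z)
    (bianchi : ∀ x y z w, R x y z w + R y z x w + R z x y w = 0) (x y z w : V) :
    R x y z w = R z w x y := by
  have b1 := bianchi x y z w
  have b2 := bianchi y z w x
  have b3 := bianchi z w x y
  have b4 := bianchi w x y z
  have s1 := skew y z w x
  have s2 := skew z w y x
  have s3 := skew w y z x
  have a1 := anti z x y w
  have a2 := skew x z y w
  have a3 := anti w x z y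
  have a4 := skew x w z y
  have a5 := skew x y w z
  have a6 := anti y w x z
  have a7 := skew w y x z
  have a8 := skew z w x y
  have a9 := anti x z w y
  have a10 := skew w x y z
  have a11 := skew z x w y
  linarith

variable {V : Type*} [AddCommGroup V] {R : V → V → V → V → ℝ} {B : V → V → ℝ} {J : V → V} {c : ℝ}

/-- A Kaehler curvature tensor of constant holomorphic sectional curvature `c` is determined on
planes by the metric and the complex structure. -/
theorem sectional_of_holomorphic_sectional
    (add : ∀ a b y z w, R (a + b) y z w = R a y z w + R b y z w)
    (anti : ∀ x y z w, R x y z w = - R y x z w)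
    (skew : ∀ x y z w, R x y z w = - R x y w z)
    (bianchi : ∀ x y z w, R x y z w + R y z x w + R z x y w = 0)
    (hJ : ∀ x y z w, R x y (J z) (J w) = R x y z w)
    (Jadd : ∀ x y, J (x + y) = J x + J y) (JJ : ∀ x, J (J x) = -x)
    (Badd : ∀ a b y, B (a + b) y = B a y + B b y) (Bsymm : ∀ a b, B a b = B b a)
    (BJ : ∀ a b, B (J a) (J b) = B a b)
    (hc : ∀ v, R v (J v) (J v) v = c * B v v ^ 2) (x y : V) :
    R x y y x = c / 4 * (B x x * B y y - B x y ^ 2 + 3 * B x (J y) ^ 2) := by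
  have pair := curvature_pair_symm anti skew bianchi
  -- Polarization only evaluates at x + y and x - y, so additivity and its consequence for signs
  -- suffice.
  have neg1 : ∀ a y z w, R (-a) y z w = - R a y z w := fun a y z w => by
    have h0 := add 0 0 y z w
    have h1 := add a (-a) y z w
    rw [add_zero] at h0
    rw [add_neg_cancel] at h1
    linarith
  have add2 : ∀ x a b z w, R x (a + b) z w = R x a z w + R x b z w := fun x a b z w => by
    rw [anti, add, anti x a, anti x b]; ring
  have neg2 : ∀ x a z w, R x (-a) z w = - R x a z w := fun x a z w => by
    rw [anti, neg1, anti x a]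
  have add3 : ∀ x y a b w, R x y (a + b) w = R x y a w + R x y b w := fun x y a b w => by
    rw [pair, add, pair x y a, pair x y b]
  have neg3 : ∀ x y a w, R x y (-a) w = - R x y a w := fun x y a w => by
    rw [pair, neg1, pair x y a]
  have add4 : ∀ x y z a b, R x y z (a + b) = R x y z a + R x y z b := fun x y z a b => by
    rw [skew, add3, skew x y z a, skew x y z b]; ring
  have neg4 : ∀ x y z a, R x y z (-a) = - R x y z a := fun x y z a => by
    rw [skew, neg3, skew x y z a]
  have J0 : J 0 = 0 := by
    have := Jadd 0 0
    rw [add_zero] at this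
    exact left_eq_add.1 this
  have Jneg : ∀ a, J (-a) = - J a := fun a => by
    have := Jadd a (-a)
    rw [add_neg_cancel, J0] at this
    exact (neg_eq_of_add_eq_zero_right this.symm).symm
  have Bneg : ∀ a y, B (-a) y = - B a y := fun a y => by
    have h0 := Badd 0 0 y
    have h1 := Badd a (-a) y
    rw [add_zero] at h0
    rw [add_neg_cancel] at h1
    linarith
  have Badd2 : ∀ a b y, B y (a + b) = B y a + B y b := fun a b y => by
    rw [Bsymm, Badd, Bsymm a, Bsymm b]
  have Bneg2 : ∀ a y, B y (-a) = - B y a := fun a y => by rw [Bsymm, Bneg, Bsymm]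
  have hJ1 : ∀ x y z w, R (J x) (J y) z w = R x y z w := fun x y z w => by
    rw [pair, hJ, pair]
  have hJ2 : ∀ x y z w, R x y (J z) w = - R x y z (J w) := fun x y z w => by
    rw [← hJ x y z (J w), JJ, neg4, neg_neg]
  -- Adding the hypothesis at x + y and x - y isolates the part of bidegree (2, 2): six curvature
  -- terms. Four equal R(x, Jy, Jy, x) by J-invariance; by Bianchi the other two equal R(x, y, y, x)
  -- + R(x, Jy, Jy, x).
  have key : ∀ x y, 2 * R x y y x + 6 * R x (J y) (J y) x =
      c * (2 * (B x x * B y y) + 4 * B x y ^ 2) := by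
    intro x y
    have q1 := hc (x + y)
    have q2 := hc (x + -y)
    simp only [Jadd, Jneg, add, add2, add3, add4, neg1, neg2, neg3, neg4, Badd, Bneg, Badd2,
      Bneg2] at q1 q2
    have qx := hc x
    have qy := hc y
    have f1 : R y (J x) (J x) y = R x (J y) (J y) x := by
      rw [← hJ1 y (J x), JJ, neg2, hJ2, neg_neg, anti, skew]
      have : R x (J y) x (J y) = - R x (J y) (J y) x := skew _ _ _ _
      linarith
    have f2 : R x (J y) (J x) y = R x (J y) (J y) x := by
      rw [hJ2, skew x (J y) x]; ring
    have f2' : R y (J x) (J y) x = R x (J y) (J y) x := by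
      rw [hJ2, ← skew y (J x) (J x) y, f1]
    have f3 : R x (J x) (J y) y = R x y y x + R x (J y) (J y) x := by
      have b := bianchi x (J x) (J y) y
      have e1 : R (J x) (J y) x y = - R x y y x := by rw [hJ1, skew]
      have e2 : R (J y) x (J x) y = - R x (J y) (J y) x := by rw [anti, f2]
      linarith
    have f3' : R y (J y) (J x) x = R x y y x + R x (J y) (J y) x := by
      rw [pair, anti, skew, neg_neg, f3]
    rw [Bsymm y x] at q1 q2
    linear_combination (q1 + q2) / 2 - qx - qy - f1 - f2 - f2' - f3 - f3'
  have k1 := key x y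
  -- Replacing y by Jy exchanges the two unknowns; 3 k2 - k1 then eliminates R(x, Jy, Jy, x).
  have k2 := key x (J y)
  rw [JJ, neg2, neg3, neg_neg, BJ] at k2
  linear_combination (3 * k2 - k1) / 16

end CurvatureTensor

/-! ### The sharp inequality for totally symmetric 3-tensors. -/

section SymmetricTensor

variable {ι : Type*} [Fintype ι] [DecidableEq ι]

open Finset

/-- The estimate of the Ricci curvature by the trace vector `τ k = ∑ j, T j j k` of a totally
symmetric tensor, with its defect. -/
theorem symmetric_tensor_estimate {T : ι → ι → ι → ℝ} (h12 : ∀ i j k, T i j k = T j i k)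
    (h23 : ∀ i j k, T i j k = T i k j) {n : ℝ} (hn : (Fintype.card ι : ℝ) = n) (hn2 : 2 ≤ n)
    {τ : ι → ℝ} (hτ : ∀ k, τ k = ∑ j, T j j k) (a : ι) :
    ∑ j, ∑ k, (T j j k * T a a k - T j a k ^ 2)
      + ∑ k ∈ univ.erase a,
          (2 * (T a a k - τ k / 4) ^ 2 + ((n - 1) / (4 * n) - 1 / 8) * τ k ^ 2)
      + n / (n - 1) * (T a a a - (n + 1) / (2 * n) * τ a) ^ 2
      ≤ (n - 1) / (4 * n) * ∑ k, τ k ^ 2 := by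
  have hcard : ((univ.erase a).card : ℝ) = n - 1 := by
    rw [card_erase_of_mem (mem_univ a), card_univ, Nat.cast_sub, hn, Nat.cast_one]
    exact Fintype.card_pos_iff.2 ⟨a⟩
  have e1 : ∑ j, ∑ k, T j j k * T a a k = ∑ k, τ k * T a a k := by
    rw [sum_comm]
    exact sum_congr rfl fun k _ => by rw [hτ, sum_mul]
  -- In row j ≠ a only the entries k = a and k = j are kept; squares with j, a, k all distinct are
  -- discarded.
  have e2 : ∑ k, T a a k ^ 2 + ∑ j ∈ univ.erase a, (T a a j ^ 2 + T j j a ^ 2) ≤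
      ∑ j, ∑ k, T j a k ^ 2 := by
    rw [← add_sum_erase univ (fun j => ∑ k, T j a k ^ 2) (mem_univ a)]
    refine add_le_add le_rfl (sum_le_sum fun j hj => ?_)
    have hja : a ≠ j := (ne_of_mem_erase hj).symm
    calc T a a j ^ 2 + T j j a ^ 2 = ∑ k ∈ {a, j}, T j a k ^ 2 := by
          rw [sum_pair hja, h12 j a a, h23 a j a, h23 j a j]
      _ ≤ ∑ k, T j a k ^ 2 :=
          sum_le_sum_of_subset_of_nonneg (subset_univ _) fun _ _ _ => sq_nonneg _
  -- Cauchy-Schwarz for the n - 1 numbers T_jja, j ≠ a, whose sum is τ_a - T_aaa.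
  have e3 : (τ a - T a a a) ^ 2 ≤ (n - 1) * ∑ j ∈ univ.erase a, T j j a ^ 2 := by
    have h1 : τ a - T a a a = ∑ j ∈ univ.erase a, T j j a := by
      rw [hτ, ← add_sum_erase univ (fun j => T j j a) (mem_univ a)]; ring
    rw [h1, ← hcard]
    exact sq_sum_le_card_mul_sum_sq
  have e4 : (τ a - T a a a) ^ 2 / (n - 1) ≤ ∑ j ∈ univ.erase a, T j j a ^ 2 := by
    rw [div_le_iff₀ (by linarith)]; linarith
  have e5 : ∑ j, ∑ k, (T j j k * T a a k - T j a k ^ 2) =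
      ∑ k, τ k * T a a k - ∑ j, ∑ k, T j a k ^ 2 := by
    rw [← e1]; simp only [sum_sub_distrib]
  -- Completion of the square: t ↦ τt - t² - (τ - t)²/(n-1) is largest at t = (n+1)τ/(2n), with
  -- value (n-1)τ²/(4n).
  have e6 : (n - 1) / (4 * n) * τ a ^ 2 = τ a * T a a a - T a a a ^ 2
      - (τ a - T a a a) ^ 2 / (n - 1)
      + n / (n - 1) * (T a a a - (n + 1) / (2 * n) * τ a) ^ 2 := by
    have h1 : n - 1 ≠ 0 := by linarith
    have h2 : n ≠ 0 := by linarith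
    field_simp
    ring
  -- Termwise τt - 2t² = τ²/8 - 2(t - τ/4)²; the constant 1/8 is then raised to (n-1)/(4n).
  have e7 : ∑ k ∈ univ.erase a, τ k * T a a k - ∑ k ∈ univ.erase a, T a a k ^ 2
      - ∑ k ∈ univ.erase a, T a a k ^ 2 + ∑ k ∈ univ.erase a,
          (2 * (T a a k - τ k / 4) ^ 2 + ((n - 1) / (4 * n) - 1 / 8) * τ k ^ 2) =
      (n - 1) / (4 * n) * ∑ k ∈ univ.erase a, τ k ^ 2 := by
    rw [mul_sum, ← sum_sub_distrib, ← sum_sub_distrib, ← sum_add_distrib]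
    exact sum_congr rfl fun k _ => by ring
  rw [e5]
  rw [sum_add_distrib] at e2
  rw [← add_sum_erase univ (fun k => τ k ^ 2) (mem_univ a),
    ← add_sum_erase univ (fun k => τ k * T a a k) (mem_univ a)]
  rw [← add_sum_erase univ (fun k => T a a k ^ 2) (mem_univ a)] at e2
  linarith

/-- The coefficient is zero exactly at n = 2, which is why a nonzero equality case survives only in
dimension two. -/
theorem defect_coeff_nonneg {n : ℝ} (hn2 : 2 ≤ n) : 0 ≤ (n - 1) / (4 * n) - 1 / 8 := by
  rw [sub_nonneg, div_le_div_iff₀ (by norm_num) (by linarith)]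
  linarith

theorem symmetric_tensor_ineq {T : ι → ι → ι → ℝ} (h12 : ∀ i j k, T i j k = T j i k)
    (h23 : ∀ i j k, T i j k = T i k j) {n : ℝ} (hn : (Fintype.card ι : ℝ) = n) (hn2 : 2 ≤ n)
    {τ : ι → ℝ} (hτ : ∀ k, τ k = ∑ j, T j j k) (a : ι) :
    ∑ j, ∑ k, (T j j k * T a a k - T j a k ^ 2) ≤ (n - 1) / (4 * n) * ∑ k, τ k ^ 2 := by
  have h := symmetric_tensor_estimate h12 h23 hn hn2 hτ a
  have h0 := defect_coeff_nonneg hn2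
  have h1 : 0 ≤ ∑ k ∈ univ.erase a,
      (2 * (T a a k - τ k / 4) ^ 2 + ((n - 1) / (4 * n) - 1 / 8) * τ k ^ 2) :=
    sum_nonneg fun k _ => by positivity
  have h2 : 0 ≤ n / (n - 1) * (T a a a - (n + 1) / (2 * n) * τ a) ^ 2 :=
    mul_nonneg (div_nonneg (by linarith) (by linarith)) (sq_nonneg _)
  linarith

/-- The defects in `symmetric_tensor_estimate` are nonnegative, so equality makes each of them
vanish. For n > 2 the coefficient of τ_k² is positive, which gives the last clause. -/
theorem symmetric_tensor_eq {T : ι → ι → ι → ℝ} (h12 : ∀ i j k, T i j k = T j i k)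
    (h23 : ∀ i j k, T i j k = T i k j) {n : ℝ} (hn : (Fintype.card ι : ℝ) = n) (hn2 : 2 ≤ n)
    {τ : ι → ℝ} (hτ : ∀ k, τ k = ∑ j, T j j k) {a : ι}
    (heq : ∑ j, ∑ k, (T j j k * T a a k - T j a k ^ 2) = (n - 1) / (4 * n) * ∑ k, τ k ^ 2) :
    T a a a = (n + 1) / (2 * n) * τ a ∧ (∀ k, k ≠ a → T a a k = τ k / 4) ∧
      (2 < n → ∀ k, k ≠ a → τ k = 0) := by
  have h := symmetric_tensor_estimate h12 h23 hn hn2 hτ a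
  have h0 := defect_coeff_nonneg hn2
  have hterm : ∀ k ∈ univ.erase a,
      0 ≤ 2 * (T a a k - τ k / 4) ^ 2 + ((n - 1) / (4 * n) - 1 / 8) * τ k ^ 2 :=
    fun k _ => by positivity
  have h1 := sum_nonneg hterm
  have h3 : 0 < n / (n - 1) := div_pos (by linarith) (by linarith)
  have h2 : 0 ≤ n / (n - 1) * (T a a a - (n + 1) / (2 * n) * τ a) ^ 2 :=
    mul_nonneg h3.le (sq_nonneg _)
  have hz : ∀ k, k ≠ a →
      2 * (T a a k - τ k / 4) ^ 2 + ((n - 1) / (4 * n) - 1 / 8) * τ k ^ 2 = 0 := fun k hk =>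
    (sum_eq_zero_iff_of_nonneg hterm).1 (by linarith) k (mem_erase.2 ⟨hk, mem_univ k⟩)
  refine ⟨?_, fun k hk => ?_, fun hn3 k hk => ?_⟩
  · have h4 : n / (n - 1) * (T a a a - (n + 1) / (2 * n) * τ a) ^ 2 = 0 := by linarith
    have h5 := pow_eq_zero_iff (two_ne_zero) |>.1 ((mul_eq_zero.1 h4).resolve_left h3.ne')
    linarith
  · have h4 : 0 ≤ ((n - 1) / (4 * n) - 1 / 8) * τ k ^ 2 := mul_nonneg h0 (sq_nonneg _)
    have h5 : (T a a k - τ k / 4) ^ 2 = 0 := by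
      nlinarith [hz k hk, sq_nonneg (T a a k - τ k / 4)]
    have h6 := pow_eq_zero_iff (two_ne_zero) |>.1 h5
    linarith
  · have h4 : 0 < (n - 1) / (4 * n) - 1 / 8 := by
      rw [sub_pos, div_lt_div_iff₀ (by norm_num) (by linarith)]
      linarith
    have h5 : ((n - 1) / (4 * n) - 1 / 8) * τ k ^ 2 = 0 := by
      have := hz k hk
      have h6 : 0 ≤ ((n - 1) / (4 * n) - 1 / 8) * τ k ^ 2 := by positivity
      nlinarith [sq_nonneg (T a a k - τ k / 4)]
    exact pow_eq_zero_iff (two_ne_zero) |>.1 ((mul_eq_zero.1 h5).resolve_left h4.ne')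

end SymmetricTensor

/-! ### Orthonormal frames of a positive definite form. -/

section Frames

variable {E : Type*} [AddCommGroup E] [Module ℝ E] {ι : Type*} [Fintype ι] [DecidableEq ι]

/-- A basis which is orthonormal for the bilinear form `B`. -/
def IsFrame (B : E →ₗ[ℝ] E →ₗ[ℝ] ℝ) (e : Module.Basis ι ℝ E) : Prop :=
  ∀ i j, B (e i) (e j) = if i = j then 1 else 0

variable {B : E →ₗ[ℝ] E →ₗ[ℝ] ℝ}

theorem IsFrame.repr_apply {e : Module.Basis ι ℝ E} (he : IsFrame B e) (x : E) (i : ι) :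
    e.repr x i = B x (e i) := by
  conv_rhs => rw [← e.sum_repr x]
  simp only [map_sum, LinearMap.sum_apply, map_smul, LinearMap.smul_apply, he _ _]
  simp

theorem IsFrame.sum_smul {e : Module.Basis ι ℝ E} (he : IsFrame B e) (x : E) :
    ∑ i, B x (e i) • e i = x := by
  simp only [← he.repr_apply, e.sum_repr]

theorem IsFrame.trace {e : Module.Basis ι ℝ E} (he : IsFrame B e) (f : E →ₗ[ℝ] E) :
    LinearMap.trace ℝ E f = ∑ i, B (f (e i)) (e i) := by
  rw [LinearMap.trace_eq_matrix_trace ℝ e, Matrix.trace]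
  simp [LinearMap.toMatrix_apply, he.repr_apply]

theorem exists_isFrame [FiniteDimensional ℝ E] (hs : ∀ u v, B u v = B v u)
    (hp : ∀ u, u ≠ 0 → 0 < B u u) (hι : Fintype.card ι = Module.finrank ℝ E) {X : E}
    (hX : B X X = 1) (a : ι) : ∃ e : Module.Basis ι ℝ E, IsFrame B e ∧ e a = X := by
  -- E carries no norm in this section, so the one induced by B can be installed locally and {X}
  -- extended to an orthonormal basis.
  let core : InnerProductSpace.Core ℝ E :=
    { inner := fun u v => B u v
      conj_inner_symm := fun u v => by simpa using hs v u
      re_inner_nonneg := fun u => by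
        by_cases h : u = 0
        · simp [h]
        · simpa using (hp u h).le
      add_left := fun u v w => by simp
      smul_left := fun u v r => by simp
      definite := fun u h => by
        by_contra hne
        exact (hp u hne).ne' h }
  let _ : NormedAddCommGroup E := core.toNormedAddCommGroup
  let _ : InnerProductSpace ℝ E := InnerProductSpace.ofCore core.toCore
  have hinner : ∀ u v : E, inner ℝ u v = B u v := fun _ _ => rfl
  have hon : Orthonormal ℝ (({a} : Set ι).domRestrict fun _ => X) := by
    rw [orthonormal_iff_ite]
    intro i j
    have : i = j := Subsingleton.elim _ _
    rw [if_pos this]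
    exact hX
  obtain ⟨b, hb⟩ := hon.exists_orthonormalBasis_extension_of_card_eq hι.symm
  refine ⟨b.toBasis, fun i j => ?_, by simpa using hb a rfl⟩
  have := orthonormal_iff_ite.1 b.orthonormal i j
  simpa [hinner] using this

theorem exists_smul_unit (hp : ∀ u, u ≠ 0 → 0 < B u u) {Z : E} (hZ : Z ≠ 0) :
    ∃ r : ℝ, r ≠ 0 ∧ B (r • Z) (r • Z) = 1 := by
  have h := hp Z hZ
  refine ⟨(√(B Z Z))⁻¹, inv_ne_zero (Real.sqrt_pos.2 h).ne', ?_⟩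
  simp only [map_smul, LinearMap.smul_apply, smul_eq_mul]
  rw [← mul_assoc, ← mul_inv, Real.mul_self_sqrt h.le, inv_mul_cancel₀ h.ne']

theorem exists_isFrame_of_orthonormal [FiniteDimensional ℝ E]
    (hι : Fintype.card ι = Module.finrank ℝ E) {e : ι → E}
    (he : ∀ i j, B (e i) (e j) = if i = j then 1 else 0) :
    ∃ b : Module.Basis ι ℝ E, IsFrame B b ∧ ∀ i, b i = e i := by
  have hli : LinearIndependent ℝ e := by
    rw [Fintype.linearIndependent_iff]
    intro c hc i
    have := congrArg (fun x => B x (e i)) hc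
    simpa [he] using this
  rcases isEmpty_or_nonempty ι with hE | hE
  · have : Module.finrank ℝ E = 0 := by rw [← hι, Fintype.card_eq_zero]
    have hsub : Subsingleton E := Module.finrank_zero_iff.1 this
    exact ⟨Module.Basis.empty E, fun i => hE.elim i, fun i => hE.elim i⟩
  · refine ⟨basisOfLinearIndependentOfCardEqFinrank hli hι, fun i j => ?_, fun i => ?_⟩
    · simpa using he i j
    · simp

end Frames

/-! ### The inequality and its equality case at a single point. -/

section Pointwise

open Finset

variable {E F : Type*} [AddCommGroup E] [Module ℝ E] [AddCommGroup F] [Module ℝ F]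

/-- The algebraic properties of the second fundamental form `σ` of a Lagrangian submanifold at a
point: `j = J ∘ df` is an isometry onto the normal space, and `H(σ(u, v), j w)` is totally
symmetric. -/
structure IsLagrangianForm (B : E →ₗ[ℝ] E →ₗ[ℝ] ℝ) (H : F →ₗ[ℝ] F →ₗ[ℝ] ℝ) (j : E →ₗ[ℝ] F)
    (σ : E →ₗ[ℝ] E →ₗ[ℝ] F) : Prop where
  symm : ∀ u v, B u v = B v u
  pos : ∀ u, u ≠ 0 → 0 < B u u
  isometric : ∀ u v, H (j u) (j v) = B u v
  mem_range : ∀ u v, ∃ w, σ u v = j w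
  form_symm : ∀ u v, σ u v = σ v u
  cubic_symm : ∀ u v w, H (σ u v) (j w) = H (σ u w) (j v)

theorem exists_univ_eq_pair {ι : Type*} [Fintype ι] [DecidableEq ι]
    (hι : Fintype.card ι = 2) (a : ι) :
    ∃ b, a ≠ b ∧ (univ : Finset ι) = {a, b} := by
  rw [← card_univ, card_eq_two] at hι
  obtain ⟨x, y, hxy, hu⟩ := hι
  have ha := mem_univ a
  rw [hu, mem_insert, mem_singleton] at ha
  rcases ha with rfl | rfl
  · exact ⟨y, hxy, hu⟩
  · exact ⟨x, hxy.symm, by rw [hu, pair_comm]⟩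

namespace IsLagrangianForm

variable {B : E →ₗ[ℝ] E →ₗ[ℝ] ℝ} {H : F →ₗ[ℝ] F →ₗ[ℝ] ℝ} {j : E →ₗ[ℝ] F}
  {σ : E →ₗ[ℝ] E →ₗ[ℝ] F}

/-- A symmetric trilinear form is determined by its diagonal through polarization, and σ takes
values in the range of j, where H is definite. -/
theorem eq_zero_of_cubic (h : IsLagrangianForm B H j σ) (h0 : ∀ u, H (σ u u) (j u) = 0) (u v : E) :
    σ u v = 0 := by
  have h2 : ∀ u v, H (σ u u) (j v) = 0 := fun u v => by
    have p1 := h0 (u + v)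
    have p2 := h0 (u - v)
    simp only [map_add, map_sub, LinearMap.add_apply, LinearMap.sub_apply] at p1 p2
    have c1 := h.cubic_symm u v u
    have c2 : H (σ v u) (j u) = H (σ u u) (j v) := by rw [h.form_symm v u, c1]
    have u0 := h0 u
    have v0 := h0 v
    linarith
  have h3 : ∀ w, H (σ u v) (j w) = 0 := fun w => by
    have p1 := h2 (u + v) w
    simp only [map_add, LinearMap.add_apply] at p1
    rw [h.form_symm v u, h2 u w, h2 v w] at p1
    linarith
  obtain ⟨t, ht⟩ := h.mem_range u v
  have h4 := h3 t
  rw [ht, h.isometric] at h4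
  by_cases h5 : t = 0
  · rw [ht, h5, map_zero]
  · exact absurd h4 (h.pos t h5).ne'

variable {ι : Type*} [Fintype ι] [DecidableEq ι] {e : Module.Basis ι ℝ E}

theorem eq_sum (h : IsLagrangianForm B H j σ) (he : IsFrame B e) (u v : E) :
    σ u v = ∑ k, H (σ u v) (j (e k)) • j (e k) := by
  obtain ⟨t, ht⟩ := h.mem_range u v
  conv_lhs => rw [ht, ← he.sum_smul t]
  simp only [map_sum, map_smul, ht, h.isometric]

theorem pairing_eq_sum (h : IsLagrangianForm B H j σ) (he : IsFrame B e) (x : F) (w z : E) :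
    H x (σ w z) = ∑ k, H x (j (e k)) * H (σ w z) (j (e k)) := by
  conv_lhs => rw [h.eq_sum he w z]
  simp only [map_sum, map_smul, smul_eq_mul, mul_comm]

variable {n : ℕ} {c : ℝ} {ric : E → ℝ} {η : F}

theorem mean_pairing
    (hη : ∀ e : Module.Basis ι ℝ E, IsFrame B e → (n : ℝ) • η = ∑ i, σ (e i) (e i))
    (he : IsFrame B e) (w : E) : (n : ℝ) * H η (j w) = ∑ i, H (σ (e i) (e i)) (j w) := by
  have := congrArg (fun x => H x (j w)) (hη e he)
  simpa [LinearMap.sum_apply] using this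

theorem mean_sq (h : IsLagrangianForm B H j σ)
    (hη : ∀ e : Module.Basis ι ℝ E, IsFrame B e → (n : ℝ) • η = ∑ i, σ (e i) (e i))
    (he : IsFrame B e) : (n : ℝ) ^ 2 * H η η = ∑ k, ((n : ℝ) * H η (j (e k))) ^ 2 := by
  have h1 : (n : ℝ) * H η η = ∑ i, H η (σ (e i) (e i)) := by
    have := congrArg (fun x => H η x) (hη e he)
    simpa using this
  have h2 : ∀ k, ((n : ℝ) * H η (j (e k))) ^ 2 =
      (n : ℝ) * ∑ i, H η (j (e k)) * H (σ (e i) (e i)) (j (e k)) := fun k => by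
    rw [← mul_sum, ← mean_pairing hη he]; ring
  rw [pow_two, mul_assoc, h1, sum_congr rfl fun k _ => h2 k, ← mul_sum, sum_comm]
  congr 1
  exact sum_congr rfl fun i _ => h.pairing_eq_sum he _ _ _

theorem ric_eq (h : IsLagrangianForm B H j σ)
    (hric : ∀ e : Module.Basis ι ℝ E, IsFrame B e → ∀ X, ric X = ((n : ℝ) - 1) / 4 * c * B X X +
      ∑ i, (H (σ (e i) (e i)) (σ X X) - H (σ (e i) X) (σ (e i) X)))
    (he : IsFrame B e) (a : ι) : ric (e a) = ((n : ℝ) - 1) / 4 * c +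
      ∑ i, ∑ k, (H (σ (e i) (e i)) (j (e k)) * H (σ (e a) (e a)) (j (e k))
        - H (σ (e i) (e a)) (j (e k)) ^ 2) := by
  rw [hric e he, he a a, if_pos rfl, mul_one]
  congr 1
  refine sum_congr rfl fun i _ => ?_
  rw [h.pairing_eq_sum he, h.pairing_eq_sum he, ← sum_sub_distrib]
  exact sum_congr rfl fun k _ => by ring

theorem cubic_swap (h : IsLagrangianForm B H j σ) (u v w : E) :
    H (σ u v) (j w) = H (σ v u) (j w) := by rw [h.form_symm]

/-- Reads off the vanishing defects from equality at e_a. The formulas for `ric` and `η` are assumed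
in every frame because the equality cases pass to adapted frames. -/
theorem eq_conditions (h : IsLagrangianForm B H j σ) (hn : 2 ≤ n) (hι : Fintype.card ι = n)
    (hric : ∀ e : Module.Basis ι ℝ E, IsFrame B e → ∀ X, ric X = ((n : ℝ) - 1) / 4 * c * B X X +
      ∑ i, (H (σ (e i) (e i)) (σ X X) - H (σ (e i) X) (σ (e i) X)))
    (hη : ∀ e : Module.Basis ι ℝ E, IsFrame B e → (n : ℝ) • η = ∑ i, σ (e i) (e i))
    (heq : ∀ X, B X X = 1 → ric X = ((n : ℝ) - 1) / 4 * (c + n * H η η))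
    (he : IsFrame B e) (a : ι) :
    H (σ (e a) (e a)) (j (e a)) = ((n : ℝ) + 1) / (2 * n) * (n * H η (j (e a))) ∧
    (∀ k, k ≠ a → H (σ (e a) (e a)) (j (e k)) = n * H η (j (e k)) / 4) ∧
    (2 < (n : ℝ) → ∀ k, k ≠ a → n * H η (j (e k)) = 0) := by
  have hn' : (2 : ℝ) ≤ n := by exact_mod_cast hn
  refine symmetric_tensor_eq (T := fun i l k => H (σ (e i) (e l)) (j (e k)))
    (τ := fun k => n * H η (j (e k)))
    (fun _ _ _ => h.cubic_swap _ _ _) (fun _ _ _ => h.cubic_symm _ _ _)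
    (by rw [hι]) hn' (fun k => mean_pairing hη he (e k)) ?_
  have h1 := heq (e a) (by simp [he a a])
  rw [h.ric_eq hric he] at h1
  rw [← h.mean_sq hη he]
  have h2 : ((n : ℝ) - 1) / (4 * n) * (n ^ 2 * H η η) = ((n : ℝ) - 1) / 4 * (n * H η η) := by
    field_simp
  linarith

variable [FiniteDimensional ℝ E]

/-- The improved Chen-Ricci inequality at a point. -/
theorem ric_le (h : IsLagrangianForm B H j σ) (hn : 2 ≤ n) (hι : Fintype.card ι = n)
    (hE : Module.finrank ℝ E = n)
    (hric : ∀ e : Module.Basis ι ℝ E, IsFrame B e → ∀ X, ric X = ((n : ℝ) - 1) / 4 * c * B X X +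
      ∑ i, (H (σ (e i) (e i)) (σ X X) - H (σ (e i) X) (σ (e i) X)))
    (hη : ∀ e : Module.Basis ι ℝ E, IsFrame B e → (n : ℝ) • η = ∑ i, σ (e i) (e i))
    {X : E} (hX : B X X = 1) : ric X ≤ ((n : ℝ) - 1) / 4 * (c + n * H η η) := by
  have hn' : (2 : ℝ) ≤ n := by exact_mod_cast hn
  have : Nonempty ι := Fintype.card_pos_iff.1 (by omega)
  obtain ⟨e, he, rfl⟩ := exists_isFrame h.symm h.pos (hι.trans hE.symm) hX (Classical.arbitrary ι)
  rw [h.ric_eq hric he]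
  have h1 := symmetric_tensor_ineq (T := fun i l k => H (σ (e i) (e l)) (j (e k)))
    (fun _ _ _ => h.cubic_swap _ _ _) (fun _ _ _ => h.cubic_symm _ _ _)
    (by rw [hι]) hn' (fun k => mean_pairing hη he (e k)) (Classical.arbitrary ι)
  rw [← h.mean_sq hη he] at h1
  have h2 : ((n : ℝ) - 1) / (4 * n) * (n ^ 2 * H η η) = ((n : ℝ) - 1) / 4 * (n * H η η) := by
    field_simp
  linarith

/-- Equality at a second frame vector e_b forces τ_a = 0; then equality at e_a gives T_aaa = 0. As
e_a can be any unit vector, the cubic form vanishes on the diagonal. -/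
theorem geodesic_of_eq (h : IsLagrangianForm B H j σ) (hn : 2 < n) (hι : Fintype.card ι = n)
    (hE : Module.finrank ℝ E = n)
    (hric : ∀ e : Module.Basis ι ℝ E, IsFrame B e → ∀ X, ric X = ((n : ℝ) - 1) / 4 * c * B X X +
      ∑ i, (H (σ (e i) (e i)) (σ X X) - H (σ (e i) X) (σ (e i) X)))
    (hη : ∀ e : Module.Basis ι ℝ E, IsFrame B e → (n : ℝ) • η = ∑ i, σ (e i) (e i))
    (heq : ∀ X, B X X = 1 → ric X = ((n : ℝ) - 1) / 4 * (c + n * H η η)) (u v : E) :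
    σ u v = 0 := by
  refine h.eq_zero_of_cubic (fun Z => ?_) u v
  by_cases hZ : Z = 0
  · simp [hZ]
  obtain ⟨r, hr, hr1⟩ := exists_smul_unit h.pos hZ
  have : Nontrivial ι := Fintype.one_lt_card_iff_nontrivial.1 (by omega)
  obtain ⟨a, b, hab⟩ := exists_pair_ne ι
  obtain ⟨e, he, hea⟩ := exists_isFrame h.symm h.pos (hι.trans hE.symm) hr1 a
  have h1 := (h.eq_conditions hn.le hι hric hη heq he b).2.2 (by exact_mod_cast hn) a hab
  have h2 := (h.eq_conditions hn.le hι hric hη heq he a).1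
  rw [h1, mul_zero, hea] at h2
  simp only [map_smul, LinearMap.smul_apply, smul_eq_mul] at h2
  simpa [hr] using h2

theorem umbilical_of_eq (h : IsLagrangianForm B H j σ) (hι : Fintype.card ι = 2)
    (hE : Module.finrank ℝ E = 2) (hn : n = 2)
    (hric : ∀ e : Module.Basis ι ℝ E, IsFrame B e → ∀ X, ric X = ((n : ℝ) - 1) / 4 * c * B X X +
      ∑ i, (H (σ (e i) (e i)) (σ X X) - H (σ (e i) X) (σ (e i) X)))
    (hη : ∀ e : Module.Basis ι ℝ E, IsFrame B e → (n : ℝ) • η = ∑ i, σ (e i) (e i))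
    (heq : ∀ X, B X X = 1 → ric X = ((n : ℝ) - 1) / 4 * (c + n * H η η)) :
    ∃ (μ : ℝ) (e : ι → E) (a : ι), (∀ i k, B (e i) (e k) = if i = k then 1 else 0) ∧
      σ (e a) (e a) = (3 * μ) • j (e a) ∧
      (∀ i, i ≠ a → σ (e i) (e i) = μ • j (e a)) ∧
      (∀ i, i ≠ a → σ (e a) (e i) = μ • j (e i)) ∧
      (∀ i k, i ≠ a → k ≠ a → i ≠ k → σ (e i) (e k) = 0) := by
  have hcard := hι.trans hE.symm
  have : Nonempty ι := Fintype.card_pos_iff.1 (by omega)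
  obtain ⟨a⟩ := this
  obtain ⟨b, hab, huniv⟩ := exists_univ_eq_pair hι a
  have : Nontrivial E := Module.nontrivial_of_finrank_pos (R := ℝ) (by omega)
  -- The linear form H(η, j ·) on a plane has a nonzero kernel vector. Normalized, it becomes e_b,
  -- so that τ_b = 0.
  obtain ⟨Z, hZ0, hZ⟩ : ∃ Z, Z ≠ 0 ∧ H η (j Z) = 0 := by
    obtain ⟨Y, hY⟩ := exists_ne (0 : E)
    obtain ⟨r, -, hr1⟩ := exists_smul_unit h.pos hY
    obtain ⟨e, he, -⟩ := exists_isFrame h.symm h.pos hcard hr1 a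
    by_cases h0 : H η (j (e a)) = 0
    · exact ⟨e a, e.ne_zero a, h0⟩
    · refine ⟨H η (j (e b)) • e a - H η (j (e a)) • e b, fun hc => h0 ?_, ?_⟩
      · have := congrArg (fun x => B x (e b)) hc
        simpa [he a b, he b b, hab] using this
      · simp only [map_sub, map_smul, smul_eq_mul]; ring
  obtain ⟨r, -, hr1⟩ := exists_smul_unit h.pos hZ0
  obtain ⟨e, he, heb⟩ := exists_isFrame h.symm h.pos hcard hr1 b
  have hτb : H η (j (e b)) = 0 := by simp [heb, hZ]
  obtain ⟨ca1, ca2, -⟩ := h.eq_conditions (by omega) (hι.trans hn.symm) hric hη heq he a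
  obtain ⟨cb1, cb2, -⟩ := h.eq_conditions (by omega) (hι.trans hn.symm) hric hη heq he b
  have ca3 := ca2 b hab.symm
  have cb3 := cb2 a hab
  rw [hτb] at cb1 ca3
  subst hn
  have hb : ∀ i, i ≠ a → i = b := fun i hi => by
    have := mem_univ i
    rw [huniv, mem_insert, mem_singleton] at this
    exact this.resolve_left hi
  have e1 : ∀ u v, σ u v = H (σ u v) (j (e a)) • j (e a) + H (σ u v) (j (e b)) • j (e b) := by
    intro u v
    conv_lhs => rw [h.eq_sum he u v, huniv, sum_pair hab]
  have tab : H (σ (e a) (e b)) (j (e a)) = H (σ (e a) (e a)) (j (e b)) := h.cubic_symm _ _ _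
  have tba : H (σ (e a) (e b)) (j (e b)) = H (σ (e b) (e b)) (j (e a)) := by
    rw [h.form_symm, h.cubic_symm]
  norm_num at ca1 ca3 cb1 cb3
  -- With τ_a = 2 H(η, j e_a), the conditions at e_a and e_b read T_aaa = 3τ_a/4, T_bba = τ_a/4 and
  -- T_aab = T_bbb = 0, hence μ = τ_a/4. The last clause is vacuous for two indices.
  refine ⟨H η (j (e a)) / 2, e, a, he, ?_, fun i hi => ?_, fun i hi => ?_, fun i k hi hk hik =>
    absurd ((hb i hi).trans (hb k hk).symm) hik⟩
  · rw [e1, ca1, ca3, zero_smul, add_zero]; ring_nf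
  · rw [hb i hi, e1, cb1, cb3, zero_smul, add_zero]; ring_nf
  · rw [hb i hi, e1, tab, tba, ca3, cb3, zero_smul, zero_add]; ring_nf

theorem eq_of_umbilical (h : IsLagrangianForm B H j σ) (hι : Fintype.card ι = 2)
    (hE : Module.finrank ℝ E = 2) (hn : n = 2)
    (hric : ∀ e : Module.Basis ι ℝ E, IsFrame B e → ∀ X, ric X = ((n : ℝ) - 1) / 4 * c * B X X +
      ∑ i, (H (σ (e i) (e i)) (σ X X) - H (σ (e i) X) (σ (e i) X)))
    (hη : ∀ e : Module.Basis ι ℝ E, IsFrame B e → (n : ℝ) • η = ∑ i, σ (e i) (e i))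
    {μ : ℝ} {e : ι → E} {a : ι} (he : ∀ i k, B (e i) (e k) = if i = k then 1 else 0)
    (haa : σ (e a) (e a) = (3 * μ) • j (e a))
    (hii : ∀ i, i ≠ a → σ (e i) (e i) = μ • j (e a))
    (hai : ∀ i, i ≠ a → σ (e a) (e i) = μ • j (e i)) {X : E} (hX : B X X = 1) :
    ric X = ((n : ℝ) - 1) / 4 * (c + n * H η η) := by
  obtain ⟨f, hf, hfe⟩ := exists_isFrame_of_orthonormal (hι.trans hE.symm) he
  obtain ⟨b, hab, huniv⟩ := exists_univ_eq_pair hι a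
  subst hn
  have hbb := hii b hab.symm
  have habσ := hai b hab.symm
  have hba : σ (e b) (e a) = μ • j (e b) := by rw [h.form_symm, habσ]
  have hη' : η = (2 * μ) • j (e a) := by
    have h1 := hη f hf
    rw [huniv, sum_pair hab, hfe, hfe, haa, hbb, ← add_smul] at h1
    have h2 := congrArg (fun x => (2⁻¹ : ℝ) • x) h1
    simp only [smul_smul] at h2
    norm_num at h2
    rw [h2]; congr 1; ring
  have hXe : X = B X (e a) • e a + B X (e b) • e b := by
    conv_lhs => rw [← hf.sum_smul X, huniv, sum_pair hab, hfe, hfe]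
  set x := B X (e a)
  set y := B X (e b)
  have Baa : B (e a) (e a) = 1 := by simp [he]
  have Bbb : B (e b) (e b) = 1 := by simp [he]
  have Bab : B (e a) (e b) = 0 := by simp [he, hab]
  have Bba : B (e b) (e a) = 0 := by simp [he, hab.symm]
  have hxy : x ^ 2 + y ^ 2 = 1 := by
    have h1 := hX
    rw [hXe] at h1
    simp only [map_add, map_smul, LinearMap.add_apply, LinearMap.smul_apply, smul_eq_mul, Baa, Bbb,
      Bab, Bba] at h1
    linarith
  rw [hric f hf, hX, huniv, sum_pair hab, hfe, hfe, hη', hXe]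
  simp only [map_add, map_smul, LinearMap.add_apply, LinearMap.smul_apply, smul_eq_mul, haa, hbb,
    habσ, hba, h.isometric, Baa, Bbb, Bab, Bba]
  push_cast
  -- The contribution of σ to the Ricci curvature is 2μ²(x² + y²), independent of the direction, and
  -- H(η, η) = 4μ².
  linear_combination (2 * μ ^ 2) * hxy

theorem eq_of_geodesic (hn : 2 ≤ n) (hι : Fintype.card ι = n)
    (hE : Module.finrank ℝ E = n) (h : IsLagrangianForm B H j σ)
    (hric : ∀ e : Module.Basis ι ℝ E, IsFrame B e → ∀ X, ric X = ((n : ℝ) - 1) / 4 * c * B X X +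
      ∑ i, (H (σ (e i) (e i)) (σ X X) - H (σ (e i) X) (σ (e i) X)))
    (hη : ∀ e : Module.Basis ι ℝ E, IsFrame B e → (n : ℝ) • η = ∑ i, σ (e i) (e i))
    (h0 : ∀ u v, σ u v = 0) {X : E} (hX : B X X = 1) :
    ric X = ((n : ℝ) - 1) / 4 * (c + n * H η η) := by
  have : Nonempty ι := Fintype.card_pos_iff.1 (by omega)
  obtain ⟨e, he, -⟩ := exists_isFrame h.symm h.pos (hι.trans hE.symm) hX (Classical.arbitrary ι)
  have h1 := hη e he
  simp only [h0, sum_const_zero, smul_eq_zero, Nat.cast_eq_zero] at h1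
  have h2 : η = 0 := h1.resolve_left (by omega)
  rw [hric e he, h2, hX]
  simp [h0]

end IsLagrangianForm

end Pointwise

/-! ### Curvature of complex space forms. -/

section SpaceForm

variable {F : Type*} [NormedAddCommGroup F] [NormedSpace ℝ F]
  {N : Type*} [TopologicalSpace N] [ChartedSpace F N] [IsManifold 𝓘(ℝ, F) ∞ N]

/-- Both sides are homogeneous of degree four, so the hypothesis on unit vectors extends to all v,
as polarization requires. -/
theorem holomorphic_curvature_inChart {h : RiemMetric F N} {𝒥 : AlmostComplex F N} {c : ℝ}
    (hN : IsComplexSpaceForm h 𝒥 c) (q : N) (v : F) :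
    metricAt h q (curvatureOp (metricInChart h q) (extChartAt 𝓘(ℝ, F) q q) v (complexAt 𝒥 q v)
      (complexAt 𝒥 q v)) v = c * metricAt h q v v ^ 2 := by
  by_cases hv : v = 0
  · simp [hv]
  have hp := metricAt_pos h q hv
  set r : ℝ := (√(metricAt h q v v))⁻¹ with hr
  have hr2 : r * r * metricAt h q v v = 1 := by
    rw [hr, ← mul_inv, Real.mul_self_sqrt hp.le, inv_mul_cancel₀ hp.ne']
  have h1 : metricAt h q (r • v) (r • v) = 1 := by
    simp only [map_smul, smul_apply, smul_eq_mul]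
    linarith
  have h2 : metricAt h q (curvatureOp (metricInChart h q) (extChartAt 𝓘(ℝ, F) q q) (r • v)
      (complexAt 𝒥 q (r • v)) (complexAt 𝒥 q (r • v))) (r • v) = c :=
    hN.holomorphic_curvature q (r • v) h1
  simp only [curvatureOp, map_smul, smul_apply, ← smul_add, ← smul_sub, smul_eq_mul] at h2
  simp only [curvatureOp]
  generalize metricAt h q (_ + _ - _) v = K at h2 ⊢
  linear_combination (metricAt h q v v ^ 2) * h2
    - K * (r * r * metricAt h q v v + 1) * hr2

/-- The sectional curvatures of a complex space form. -/
theorem sectional_curvature_spaceForm [FiniteDimensional ℝ F] {h : RiemMetric F N} {𝒥 : AlmostComplex F N} {c : ℝ}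
    (hN : IsComplexSpaceForm h 𝒥 c) (q : N) (x y : F) :
    metricAt h q (curvatureOp (metricInChart h q) (extChartAt 𝓘(ℝ, F) q q) x y y) x =
      c / 4 * (metricAt h q x x * metricAt h q y y - metricAt h q x y ^ 2
        + 3 * metricAt h q x (complexAt 𝒥 q y) ^ 2) := by
  have hG := isLocalMetric_metricInChart h q
  have hq := mem_extChartAt_target (I := 𝓘(ℝ, F)) q
  have hc : ∀ u v, metricInChart h q (extChartAt 𝓘(ℝ, F) q q) u v = metricAt h q u v :=
    metricInChart_center h q
  have hJc : ∀ u, complexInChart 𝒥 q (extChartAt 𝓘(ℝ, F) q q) u = complexAt 𝒥 q u :=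
    complexInChart_center 𝒥 q
  have hJJ : ∀ u, complexAt 𝒥 q (complexAt 𝒥 q u) = -u := 𝒥.sq q
  have hBJ : ∀ u v, metricAt h q (complexAt 𝒥 q u) (complexAt 𝒥 q v) = metricAt h q u v :=
    hN.hermitian q
  refine sectional_of_holomorphic_sectional
    (R := fun x y z w => metricAt h q (curvatureOp (metricInChart h q)
      (extChartAt 𝓘(ℝ, F) q q) x y z) w)
    (B := fun u v => metricAt h q u v) (J := complexAt 𝒥 q) ?_ ?_ ?_ ?_ ?_ ?_ hJJ ?_
    (metricAt_symm h q) hBJ (holomorphic_curvature_inChart hN q) x y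
  · intro a b y z w
    simp only [curvatureOp, map_add, map_sub, add_apply, sub_apply]
    ring
  · intro x y z w
    rw [curvatureOp_antisymm, map_neg, neg_apply]
  · intro x y z w
    rw [← hc, hG.curvatureOp_skew hq, hG.symm _ hq, hc]
  · intro x y z w
    rw [← add_apply, ← add_apply, ← map_add, ← map_add, hG.curvatureOp_bianchi hq, map_zero,
      zero_apply]
  · intro x y z w
    have h1 := hG.curvatureOp_complex (fun y hy => contDiffAt_complexInChart 𝒥 q hy)
      (hN.parallel q) hq x y z
    rw [hJc, hJc] at h1
    rw [h1, hBJ]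
  · intro x y
    rw [map_add]
  · intro a b y
    simp

end SpaceForm

/-! ### From the geometry to the pointwise algebra, and the theorem. -/

section Submanifold

variable {E : Type*} [NormedAddCommGroup E] [NormedSpace ℝ E]
  {M : Type*} [TopologicalSpace M] [ChartedSpace E M]
  {F : Type*} [NormedAddCommGroup F] [NormedSpace ℝ F]
  {N : Type*} [TopologicalSpace N] [ChartedSpace F N] [IsManifold 𝓘(ℝ, F) ∞ N]

/-- The map `J ∘ df` at `p`. -/
def normalMap (𝒥 : AlmostComplex F N) (f : M → N) (p : M) : E →ₗ[ℝ] F :=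
  (complexAt 𝒥 (f p)).toLinearMap.comp (differential E F f p).toLinearMap

variable {h : RiemMetric F N} {𝒥 : AlmostComplex F N} {f : M → N}

theorem metricAt_differential_complexAt (hL : IsLagrangian (E := E) h 𝒥 f) (p : M) (u v : E) :
    metricAt h (f p) (differential E F f p u) (complexAt 𝒥 (f p) (differential E F f p v)) = 0 := by
  rw [metricAt_symm]
  have h1 := (hL p).subset ⟨_, ⟨v, rfl⟩, rfl⟩
  exact h1 u

variable [IsManifold 𝓘(ℝ, E) ∞ M]

/-- The metric at `q` as an algebraic bilinear form. -/
def metricForm (g : RiemMetric E M) (q : M) : E →ₗ[ℝ] E →ₗ[ℝ] ℝ :=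
  LinearMap.mk₂ ℝ (fun u v => metricAt g q u v) (by simp) (by simp) (by simp) (by simp)

/-- The second fundamental form as a bilinear map. -/
def secondFormₗ (g : RiemMetric E M) (h : RiemMetric F N) (f : M → N) (p : M) :
    E →ₗ[ℝ] E →ₗ[ℝ] F :=
  LinearMap.mk₂ ℝ (localSecondForm (metricInChart g p) (metricInChart h (f p))
    (writtenInExtChartAt 𝓘(ℝ, E) 𝓘(ℝ, F) p f) (extChartAt 𝓘(ℝ, E) p p))
    (fun a b v => by simp only [localSecondForm, ambientDeriv, map_add, add_apply]; abel)
    (fun r a v => by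
      simp only [localSecondForm, ambientDeriv, map_smul, smul_apply, smul_add, smul_sub])
    (fun a b v => by simp only [localSecondForm, ambientDeriv, map_add]; abel)
    (fun r a v => by simp only [localSecondForm, ambientDeriv, map_smul, smul_add, smul_sub])

theorem metricForm_apply (g : RiemMetric E M) (q : M) (u v : E) :
    metricForm g q u v = metricAt g q u v := rfl

variable {g : RiemMetric E M} {c : ℝ} [FiniteDimensional ℝ E]

/-- Expanding ♯(b^k) in the frame gives the coefficients b^k(e_i); summing over k first reassembles
e_i. The dimension must be nonzero for its inverse to cancel. -/
theorem meanCurvature_eq_sum (g : RiemMetric E M) (h : RiemMetric F N) (f : M → N) (p : M)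
    {ι : Type*} [Fintype ι] [DecidableEq ι] {e : Module.Basis ι ℝ E}
    (he : IsFrame (metricForm g p) e) (hE : Module.finrank ℝ E ≠ 0) :
    (Module.finrank ℝ E : ℝ) • (meanCurvature g h f p : F) =
      ∑ i, secondFormₗ g h f p (e i) (e i) := by
  set b := Module.finBasis ℝ E
  obtain ⟨s, hs, h1⟩ : ∃ s : Fin (Module.finrank ℝ E) → E,
      (∀ k w, metricAt g p (s k) w = b.coord k w) ∧ @Eq F (meanCurvature g h f p)
        (((Module.finrank ℝ E : ℝ)⁻¹) • ∑ k, secondFormₗ g h f p (b k) (s k)) := by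
    refine ⟨fun k => sharp g p (LinearMap.toContinuousLinearMap (b.coord k)), fun k w => ?_, rfl⟩
    exact congrArg (fun T : E →L[ℝ] ℝ => T w)
      ((isInvertible_of_pos (fun u hu => metricAt_pos g p hu)).self_apply_inverse
        (LinearMap.toContinuousLinearMap (b.coord k)))
  have h2 : ∀ k, secondFormₗ g h f p (b k) (s k) =
      ∑ i, secondFormₗ g h f p (b.coord k (e i) • b k) (e i) := fun k => by
    conv_lhs => rw [← he.sum_smul (s k)]
    rw [map_sum]
    refine Finset.sum_congr rfl fun i _ => ?_
    rw [metricForm_apply, hs, map_smul, map_smul, LinearMap.smul_apply]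
  refine (congrArg (fun x : F => (Module.finrank ℝ E : ℝ) • x) h1).trans ?_
  rw [smul_smul, mul_inv_cancel₀ (by exact_mod_cast hE), one_smul,
    Finset.sum_congr rfl fun k _ => h2 k, Finset.sum_comm]
  refine Finset.sum_congr rfl fun i _ => ?_
  rw [← LinearMap.sum_apply, ← map_sum]
  congr 2
  exact b.sum_repr (e i)

variable [FiniteDimensional ℝ F]

theorem secondFormₗ_normal (hf : IsIsometricImmersion g h f) (p : M) (u v w : E) :
    metricAt h (f p) (secondFormₗ g h f p u v) (differential E F f p w) = 0 := by
  have h1 := (hf.isLocalImmersion p).pairing_localSecondForm (mem_chartDomain f p) u v w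
  rw [fderiv_writtenInExtChartAt_center hf.contMDiff, writtenInExtChartAt_center,
    metricInChart_center] at h1
  exact h1

theorem isLagrangianForm (hN : IsKaehler h 𝒥) (hf : IsIsometricImmersion g h f)
    (hL : IsLagrangian (E := E) h 𝒥 f) (p : M) :
    IsLagrangianForm (metricForm g p) (metricForm h (f p)) (normalMap (E := E) 𝒥 f p)
      (secondFormₗ g h f p) where
  symm := metricAt_symm g p
  pos _ hu := metricAt_pos g p hu
  isometric u v := (hN.hermitian (f p) _ _).trans (hf.isometric p u v)
  mem_range u v := by
    have h1 : secondFormₗ g h f p u v ∈ normalSpace (E := E) h f p :=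
      fun w => secondFormₗ_normal hf p u v w
    -- Here J(TM) must be the whole normal space: normal vectors are of the form J df w.
    rw [← hL p] at h1
    obtain ⟨_, ⟨w, rfl⟩, hw⟩ := h1
    exact ⟨w, hw.symm⟩
  form_symm u v := (hf.isLocalImmersion p).localSecondForm_symm (mem_chartDomain f p) u v
  cubic_symm u v w := by
    have h1 := (hf.isLocalImmersion p).lagrangian_symm (J := complexInChart 𝒥 (f p))
      (fun y hy => contDiffAt_complexInChart 𝒥 (f p) hy) (hN.parallel (f p))
      (fun y hy => metricInChart_complexInChart_skew hN.hermitian (f p) hy)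
      (fun y hy v w => hL.inChart hf.contMDiff p hy v w) (mem_chartDomain f p) u v w
    rw [fderiv_writtenInExtChartAt_center hf.contMDiff,
      fderiv_writtenInExtChartAt_center hf.contMDiff, writtenInExtChartAt_center,
      metricInChart_center, metricInChart_center, complexInChart_center,
      complexInChart_center] at h1
    exact h1

/-- Since J df v is normal, the term 3⟨u, Jv⟩² drops out, and on tangent planes the ambient manifold
looks like a real space form of curvature c/4. -/
theorem gauss_spaceForm (hN : IsComplexSpaceForm h 𝒥 c) (hf : IsIsometricImmersion g h f)
    (hL : IsLagrangian (E := E) h 𝒥 f) (p : M) (u v : E) :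
    metricAt g p (curvatureOp (metricInChart g p) (extChartAt 𝓘(ℝ, E) p p) u v v) u =
      c / 4 * (metricAt g p u u * metricAt g p v v - metricAt g p u v ^ 2)
      + (metricForm h (f p) (secondFormₗ g h f p u u) (secondFormₗ g h f p v v)
        - metricForm h (f p) (secondFormₗ g h f p u v) (secondFormₗ g h f p u v)) := by
  have hI := hf.isLocalImmersion p
  have h1 := hI.gauss_equation (mem_chartDomain f p) u v v u
  have hD : ∀ w, fderiv ℝ (writtenInExtChartAt 𝓘(ℝ, E) 𝓘(ℝ, F) p f) (extChartAt 𝓘(ℝ, E) p p) w =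
      differential E F f p w := fderiv_writtenInExtChartAt_center hf.contMDiff p
  have hH : ∀ a b, metricInChart h (f p) (extChartAt 𝓘(ℝ, F) (f p) (f p)) a b =
      metricAt h (f p) a b := metricInChart_center h (f p)
  have hG : ∀ a b, metricInChart g p (extChartAt 𝓘(ℝ, E) p p) a b =
      metricAt g p a b := metricInChart_center g p
  have hiso : ∀ a b, metricAt h (f p) (differential E F f p a) (differential E F f p b) =
      metricAt g p a b := hf.isometric p
  rw [hD, hD, writtenInExtChartAt_center, hG, hH, hH, hH, sectional_curvature_spaceForm hN,
    hiso, hiso, hiso, metricAt_differential_complexAt hL,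
    hI.localSecondForm_symm (mem_chartDomain f p) v u, metricAt_symm h (f p)
      (localSecondForm _ _ _ _ v v)] at h1
  rw [h1]
  change _ = _ + (metricAt h (f p) (localSecondForm _ _ _ _ u u) (localSecondForm _ _ _ _ v v)
    - metricAt h (f p) (localSecondForm _ _ _ _ u v) (localSecondForm _ _ _ _ u v))
  ring

/-- The trace of the Gauss equation; the factor n - 1 is ∑_i (‖X‖² - ⟨e_i, X⟩²) = (n-1)‖X‖². -/
theorem ricci_eq_sum (hN : IsComplexSpaceForm h 𝒥 c) (hf : IsIsometricImmersion g h f)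
    (hL : IsLagrangian (E := E) h 𝒥 f) (p : M) {ι : Type*} [Fintype ι] [DecidableEq ι]
    {e : Module.Basis ι ℝ E} (he : IsFrame (metricForm g p) e) (X : E) :
    ricci g p X = ((Fintype.card ι : ℝ) - 1) / 4 * c * metricForm g p X X +
      ∑ i, (metricForm h (f p) (secondFormₗ g h f p (e i) (e i)) (secondFormₗ g h f p X X)
        - metricForm h (f p) (secondFormₗ g h f p (e i) X) (secondFormₗ g h f p (e i) X)) := by
  have h1 : ricci g p X = ∑ i, metricAt g p (curvatureOp (metricInChart g p)
      (extChartAt 𝓘(ℝ, E) p p) (e i) X X) (e i) := he.trace _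
  have h2 : metricForm g p X X = ∑ i, metricAt g p (e i) X ^ 2 := by
    have h := congrArg (fun x => metricForm g p x X) (he.sum_smul X)
    simp only [map_sum, LinearMap.sum_apply, map_smul, LinearMap.smul_apply] at h
    refine h.symm.trans (Finset.sum_congr rfl fun i _ => ?_)
    rw [smul_eq_mul, metricForm_apply, metricForm_apply, metricAt_symm g p X]
    ring
  have h3 : ∀ i, metricAt g p (e i) (e i) = 1 := fun i => (he i i).trans (if_pos rfl)
  rw [h1, Finset.sum_congr rfl fun i _ => gauss_spaceForm hN hf hL p (e i) X,
    Finset.sum_add_distrib]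
  congr 1
  simp only [h3, one_mul]
  rw [← Finset.mul_sum, Finset.sum_sub_distrib, ← h2, Finset.sum_const, Finset.card_univ,
    metricForm_apply, nsmul_eq_mul]
  ring

/-- The improved Chen-Ricci inequality for Lagrangian submanifolds of complex space forms, with its
equality case. -/
theorem chen_ricci_lagrangian {n : ℕ} (hn : 2 ≤ n) (hE : Module.finrank ℝ E = n)
    (hN : IsComplexSpaceForm h 𝒥 c) (hf : IsIsometricImmersion g h f)
    (hL : IsLagrangian (E := E) h 𝒥 f) (p : M) :
    (∀ X : E, metricForm g p X X = 1 → ricci g p X ≤ ((n : ℝ) - 1) / 4 *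
        (c + n * metricForm h (f p) (meanCurvature g h f p) (meanCurvature g h f p))) ∧
    ((∀ X : E, metricForm g p X X = 1 → ricci g p X = ((n : ℝ) - 1) / 4 *
        (c + n * metricForm h (f p) (meanCurvature g h f p) (meanCurvature g h f p))) ↔
      (IsGeodesicPoint g h f p ∨ (n = 2 ∧ ∃ μ : ℝ, IsHUmbilicalPoint g h 𝒥 f p (3 * μ) μ))) := by
  have hF := isLagrangianForm hN.toIsKaehler hf hL p
  have hι : Fintype.card (Fin (Module.finrank ℝ E)) = n := by rw [Fintype.card_fin, hE]
  have hric : ∀ e : Module.Basis (Fin (Module.finrank ℝ E)) ℝ E, IsFrame (metricForm g p) e →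
      ∀ X, ricci g p X = ((n : ℝ) - 1) / 4 * c * metricForm g p X X +
      ∑ i, (metricForm h (f p) (secondFormₗ g h f p (e i) (e i)) (secondFormₗ g h f p X X)
        - metricForm h (f p) (secondFormₗ g h f p (e i) X) (secondFormₗ g h f p (e i) X)) :=
    fun e he X => by rw [ricci_eq_sum hN hf hL p he X, hι]
  have hη : ∀ e : Module.Basis (Fin (Module.finrank ℝ E)) ℝ E, IsFrame (metricForm g p) e →
      (n : ℝ) • (meanCurvature g h f p : F) = ∑ i, secondFormₗ g h f p (e i) (e i) :=
    fun e he => by rw [← meanCurvature_eq_sum g h f p he (by omega), hE]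
  refine ⟨fun X hX => hF.ric_le hn hι hE hric hη hX, fun heq => ?_, ?_⟩
  -- For n = 2 the umbilical alternative is always the one proved; geodesic points are its case μ =
  -- 0.
  · rcases hn.eq_or_lt with h2 | h2
    · subst h2
      obtain ⟨μ, e, a, he⟩ := hF.umbilical_of_eq hι hE rfl hric hη heq
      exact Or.inr ⟨rfl, μ, e, a, he⟩
    · exact Or.inl fun u v => hF.geodesic_of_eq h2 hι hE hric hη heq u v
  · rintro (h0 | ⟨rfl, μ, e, a, he, haa, hii, hai, -⟩) X hX
    · exact hF.eq_of_geodesic hn hι hE hric hη h0 hX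
    · exact hF.eq_of_umbilical hι hE rfl hric hη he haa hii hai hX

end Submanifold

end KaehlerGeometry

end

/-- Tangent spaces are definitionally the model space and `metricForm` unfolds to `inner`, so
`chen_ricci_lagrangian` applies directly with Euclidean model spaces. -/
theorem mainTheorem5 (n m : ℕ) (hn : 2 ≤ n) (c : ℝ)
    -- the Riemannian manifold `(M, g)` of dimension `n`
    {M : Type*} [TopologicalSpace M] [ChartedSpace (EuclideanSpace ℝ (Fin n)) M]
    [IsManifold (𝓡 n) ∞ M]
    (g : KaehlerGeometry.RiemMetric (EuclideanSpace ℝ (Fin n)) M)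
    -- the complex space form `(N, J, h)` of real dimension `2 m`
    {N : Type*} [TopologicalSpace N] [ChartedSpace (EuclideanSpace ℝ (Fin (2 * m))) N]
    [IsManifold (𝓡 (2 * m)) ∞ N]
    (h : KaehlerGeometry.RiemMetric (EuclideanSpace ℝ (Fin (2 * m))) N)
    (𝒥 : KaehlerGeometry.AlmostComplex (EuclideanSpace ℝ (Fin (2 * m))) N)
    (hN : KaehlerGeometry.IsComplexSpaceForm h 𝒥 c)
    -- the Lagrangian isometric immersion
    (f : M → N) (hf : KaehlerGeometry.IsIsometricImmersion g h f)
    (hL : KaehlerGeometry.IsLagrangian (E := EuclideanSpace ℝ (Fin n)) h 𝒥 f)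
    (p : M) :
    (∀ X : TangentSpace (𝓡 n) p, g.inner p X X = 1 →
      KaehlerGeometry.ricci g p X ≤ ((n : ℝ) - 1) / 4 *
        (c + n * h.inner (f p) (KaehlerGeometry.meanCurvature g h f p)
          (KaehlerGeometry.meanCurvature g h f p))) ∧
    ((∀ X : TangentSpace (𝓡 n) p, g.inner p X X = 1 →
      KaehlerGeometry.ricci g p X = ((n : ℝ) - 1) / 4 *
        (c + n * h.inner (f p) (KaehlerGeometry.meanCurvature g h f p)
          (KaehlerGeometry.meanCurvature g h f p))) ↔
      (KaehlerGeometry.IsGeodesicPoint g h f p ∨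
        (n = 2 ∧ ∃ μ : ℝ, KaehlerGeometry.IsHUmbilicalPoint g h 𝒥 f p (3 * μ) μ))) :=
  KaehlerGeometry.chen_ricci_lagrangian hn (by simp) hN hf hL p
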